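/- For $\lambda>-\tfrac12$ let $C_m^\lambda$ ($m\ge 0$) be the Gegenbauer polynomials, defined by $C_0^\lambda(x)=1$, $C_1^\lambda(x)=2\lambda x$ and $mC_m^\lambda(x)=2(m+\lambda-1)xC_{m-1}^\lambda(x)-(m+2\lambda-2)C_{m-2}^\lambda(x)$ for $m\ge 2$. For $\lambda\neq 0$ the $n+1$ Gegenbauer–Gauss points are the zeros of $C_{n+1}^\lambda$, and $I_nu$ denotes the polynomial of degree at most $n$ that agrees with $u$ at these points. For $\rho>1$ let $\mathcal E_\rho=\{\tfrac12(w+w^{-1}) : w=\rho e^{i\theta},\ \theta\in[0,2\pi]\}$ be the Bernstein ellipse, and for $u$ analytic on and within $\mathcal E_\rho$ put $M_\rho=\max_{z\in\mathcal E_\rho}|u(z)|$. **Theorem 4.1.** Let $\rho>1$. (i) Let $\lambda>0$. There is a sequence of positive numbers $c=c_n$, depending only on $n,\lambda,\rho$, with $c_n\to1$ as $n\to\infty$, such that for every $u$ analytic on and within $\mathcal E_\rho$ and every $n\ge 1$, $$\max_{|x|\le1}|(u-I_nu)(x)|\le\frac{c_n\,\Gamma(\lambda)\,M_\rho\sqrt{\rho^2+\rho^{-2}}}{\Gamma(2\lambda)(\rho-1)^2(1+\rho^{-2})^{-\lambda}}\;\frac{n^\lambda}{\rho^n}.$$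 (ii) Let $-\tfrac12<\lambda<0$. There is a constant $D_\lambda>0$ such that, for all sufficiently large $m$, $|C_m^\lambda(x)|\le D_\lambda m^{\lambda-1}$ for all $x\in[-1,1]$. For every such constant $D_\lambda$ there is a sequence of positive numbers $c=c_n$, depending only on $n,\lambda,\rho,D_\lambda$, with $c_n\to1$ as $n\to\infty$, such that for every $u$ analytic on and within $\mathcal E_\rho$ and every $n\ge 0$, $$\max_{|x|\le1}|(u-I_nu)(x)|\le\frac{c_n\,D_\lambda\,|\Gamma(\lambda)|\,M_\rho\sqrt{\rho^2+\rho^{-2}}}{(\rho-1)^2(1-\rho^{-2})^{-\lambda}}\;\frac{1}{\rho^n}.$$ -/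

import Mathlib

open Polynomial Filter Topology

noncomputable section

namespace GegenbauerInterp

/-- The Gegenbauer (ultraspherical) polynomials in Szegő's normalization, by the recurrence
`m C_m = 2 (m + lam - 1) x C_{m-1} - (m + 2 lam - 2) C_{m-2}` for `m ≥ 2`
(below `m = n + 2`), with `C_0 = 1` and `C_1 = 2 lam x`. -/
def gegenbauer (lam : ℝ) : ℕ → ℝ[X]
  | 0 => 1
  | 1 => C (2 * lam) * X
  | n + 2 =>
      C (((n : ℝ) + 2)⁻¹) *
        (C (2 * ((n : ℝ) + 1 + lam)) * X * gegenbauer lam (n + 1)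
          - C ((n : ℝ) + 2 * lam) * gegenbauer lam n)

/-- The Gegenbauer-Gauss points of index `n`: the zeros of `C_{n+1}`. -/
def gaussPoints (lam : ℝ) (n : ℕ) : Finset ℝ :=
  (gegenbauer lam (n + 1)).roots.toFinset

/-- The Lagrange interpolation polynomial `I_n u` of `u` at the Gegenbauer-Gauss points. -/
def interpolant (lam : ℝ) (n : ℕ) (u : ℂ → ℂ) : ℂ[X] :=
  Lagrange.interpolate (gaussPoints lam n) (fun x : ℝ => (x : ℂ)) (fun x : ℝ => u (x : ℂ))

/-- The Bernstein ellipse (a curve). -/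
def bernsteinEllipse (ρ : ℝ) : Set ℂ :=
  {z | ∃ θ ∈ Set.Icc (0 : ℝ) (2 * Real.pi), ∃ w : ℂ,
    w = (ρ : ℂ) * Complex.exp ((θ : ℂ) * Complex.I) ∧ z = (w + w⁻¹) / 2}

/-- The closed region bounded by the Bernstein ellipse, whose semi-axes are
`(ρ + ρ⁻¹) / 2` and `(ρ - ρ⁻¹) / 2`. -/
def ellipseRegion (ρ : ℝ) : Set ℂ :=
  {z | (z.re / ((ρ + ρ⁻¹) / 2)) ^ 2 + (z.im / ((ρ - ρ⁻¹) / 2)) ^ 2 ≤ 1}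

/-- `M_ρ`, the maximum of `|u|` over the Bernstein ellipse (for continuous `u` and `1 < ρ` the
supremum is over a nonempty bounded set, and attained). -/
def maxOnEllipse (ρ : ℝ) (u : ℂ → ℂ) : ℝ :=
  sSup ((fun z : ℂ => ‖u z‖) '' bernsteinEllipse ρ)

/-- `D` is an admissible Szegő constant for `lam`: a positive number, independent of `m`, with
`|C_m(x)| ≤ D m ^ (lam - 1)` on `[-1, 1]` for all sufficiently large `m`. -/
def IsSzegoConstant (lam D : ℝ) : Prop :=
  0 < D ∧ ∀ᶠ m : ℕ in atTop, ∀ x ∈ Set.Icc (-1 : ℝ) 1,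
    |(gegenbauer lam m).eval x| ≤ D * (m : ℝ) ^ (lam - 1)

end GegenbauerInterp

end

/-! Hermite's formula writes the error as a contour integral over the ellipse: `2πi (u - I_n u)(x)`
is the integral of `u(z) C_{n+1}(x) / (C_{n+1}(z) (z - x))`. Substituting `z = (w + w⁻¹)/2` moves it
to the circle `|w| = ρ`. There `|z - x| ≥ (ρ-1)²/(2ρ)` and the ellipse has length at most `π √(ρ² +
ρ⁻²)`, so everything reduces to the ratio of `max |C_{n+1}|` on `[-1,1]` to `min |C_{n+1}|` on the
ellipse (`norm_sub_interpolant_le`).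

The formula needs as many nodes as the degree of `C_{n+1}`, all inside the ellipse. That the zeros
are real, simple and in `(-1,1)` is read off the three-term recurrence (`im_cgeg_mul_conj_pos`,
`wronskian_pos`, `eval_gegenbauer_div_pos`).

On the ellipse, factoring the generating function gives `C_m(z) = ∑ g_j g_k w^{j-k}` over `j + k =
m`, with `g_k = (lam)_k / k!` (`cgeg_joukowski`). Hence `C_m(z) / (g_m w^m)` tends to `(1 -
w⁻²)^{-lam}`, uniformly in `w`, and the least modulus of this limit is estimated by `(1 ±
ρ⁻²)^{-lam}`, according to the sign of `lam`. On `[-1,1]` the maximum is `C_m(1) = (2 lam)_m / m!`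
for `lam > 0`, while for `lam < 0` the Szegő bound is used. Finally `g_m ~ m^{lam-1} / Γ(lam)`
converts the ratio into Gamma factors and powers of `n`. The sequence `c_n` is the quotient of the
bound so obtained by the stated one, replaced for small `n` by any constant that works; it does not
involve `u` because the bound is linear in `M_ρ`. -/

noncomputable section

namespace GegenbauerInterp

/-! ### Complexified Gegenbauer polynomials: recurrence and parity -/

section Recurrence

variable (lam : ℝ)

/-- The complex Gegenbauer function `z ↦ C_m(z)`. -/
def cgeg (m : ℕ) (z : ℂ) : ℂ := (gegenbauer lam m).eval₂ Complex.ofRealHom z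

lemma cgeg_zero (z : ℂ) : cgeg lam 0 z = 1 := by simp [cgeg, gegenbauer]

lemma cgeg_one (z : ℂ) : cgeg lam 1 z = 2 * lam * z := by simp [cgeg, gegenbauer]

lemma cgeg_succ_succ (n : ℕ) (z : ℂ) :
    ((n : ℂ) + 2) * cgeg lam (n + 2) z =
      2 * (n + 1 + lam) * z * cgeg lam (n + 1) z - (n + 2 * lam) * cgeg lam n z := by
  have h : ((n : ℂ) + 2) ≠ 0 := by exact_mod_cast (show n + 2 ≠ 0 by omega)
  simp [cgeg, gegenbauer, eval₂_mul, eval₂_sub]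
  field_simp

lemma cgeg_ofReal (m : ℕ) (x : ℝ) : cgeg lam m x = ((gegenbauer lam m).eval x : ℝ) := by
  rw [cgeg]
  exact eval₂_at_apply Complex.ofRealHom x

lemma cgeg_eq_eval_map (m : ℕ) (z : ℂ) :
    cgeg lam m z = ((gegenbauer lam m).map Complex.ofRealHom).eval z := by
  rw [cgeg, eval_map]

lemma eval_gegenbauer_succ_succ (n : ℕ) (x : ℝ) :
    ((n : ℝ) + 2) * (gegenbauer lam (n + 2)).eval x =
      2 * (n + 1 + lam) * x * (gegenbauer lam (n + 1)).eval x
        - (n + 2 * lam) * (gegenbauer lam n).eval x := by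
  have h : ((n : ℝ) + 2) ≠ 0 := by positivity
  simp [gegenbauer]
  field_simp

lemma eval_derivative_gegenbauer_succ_succ (n : ℕ) (x : ℝ) :
    ((n : ℝ) + 2) * (derivative (gegenbauer lam (n + 2))).eval x =
      2 * (n + 1 + lam) * ((gegenbauer lam (n + 1)).eval x
        + x * (derivative (gegenbauer lam (n + 1))).eval x)
        - (n + 2 * lam) * (derivative (gegenbauer lam n)).eval x := by
  have h : ((n : ℝ) + 2) ≠ 0 := by positivity
  rw [gegenbauer]
  simp only [derivative_mul, derivative_C, derivative_X, derivative_sub, eval_mul, eval_add,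
    eval_sub, eval_C, eval_X, zero_mul, zero_add, mul_one]
  field_simp

lemma eval_gegenbauer_neg (m : ℕ) (x : ℝ) :
    (gegenbauer lam m).eval (-x) = (-1) ^ m * (gegenbauer lam m).eval x := by
  induction m using Nat.twoStepInduction with
  | zero => simp [gegenbauer]
  | one => simp [gegenbauer]
  | more n h1 h2 =>
    have h : ((n : ℝ) + 2) ≠ 0 := by positivity
    apply mul_left_cancel₀ h
    have e := eval_gegenbauer_succ_succ lam n x
    rw [eval_gegenbauer_succ_succ, h1, h2]
    linear_combination (-1) ^ (n + 2) * (-e)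

end Recurrence

/-! ### Zeros of the Gegenbauer polynomials: real, simple, inside `(-1, 1)` -/

section Zeros

variable {lam : ℝ}

/-- Multiplying the recurrence by a conjugate and taking imaginary parts expresses each such
quantity as a nonnegative term plus `n + 2 lam` times the previous one. Positivity rules out zeros
in the upper half-plane. -/
lemma im_cgeg_mul_conj_pos (h1 : -1 / 2 < lam) (h0 : lam ≠ 0) {z : ℂ} (hz : 0 < z.im) (n : ℕ) :
    0 < (cgeg lam (n + 2) z * starRingEnd ℂ (cgeg lam (n + 1) z)).im := by
  have step (n : ℕ) : ((n : ℝ) + 2) * (cgeg lam (n + 2) z * starRingEnd ℂ (cgeg lam (n + 1) z)).im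
      = 2 * (n + 1 + lam) * z.im * Complex.normSq (cgeg lam (n + 1) z)
        + (n + 2 * lam) * (cgeg lam (n + 1) z * starRingEnd ℂ (cgeg lam n z)).im := by
    have e := cgeg_succ_succ lam n z
    have e2 : ((n : ℝ) + 2) * (cgeg lam (n + 2) z * starRingEnd ℂ (cgeg lam (n + 1) z)).im
      = ((((n : ℂ) + 2) * cgeg lam (n + 2) z) * starRingEnd ℂ (cgeg lam (n + 1) z)).im := by
      simp; ring
    rw [e2, e]
    simp [Complex.normSq_apply]
    ring
  induction n with
  | zero =>
    have := step 0
    simp only [zero_add, cgeg_one, cgeg_zero, Nat.cast_zero, map_one, mul_one] at this ⊢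
    have hp : 0 < Complex.normSq (2 * lam * z) := by
      rw [Complex.normSq_pos]
      have hz0 : z ≠ 0 := by rintro rfl; simp at hz
      simp [h0, hz0]
    have h2 : (2 * lam * z : ℂ).im = 2 * lam * z.im := by simp
    rw [h2] at this
    have h3 : 0 < 2 * (1 + lam) * z.im * Complex.normSq (2 * lam * z) :=
      mul_pos (mul_pos (by linarith) hz) hp
    -- The coefficient `2 lam` may be negative here, but `C_1 = 2 lam z` supplies a second factor
    -- `lam`. From the next index on, `n + 2 lam > 0`.
    have h4 : 0 ≤ 2 * lam * (2 * lam * z.im) := by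
      have := mul_nonneg (sq_nonneg (2 * lam)) hz.le
      linarith
    linarith
  | succ n ih =>
    have := step (n + 1)
    push_cast at this
    have h3 : 0 ≤ 2 * ((n : ℝ) + 1 + 1 + lam) * z.im * Complex.normSq (cgeg lam (n + 1 + 1) z) :=
      mul_nonneg (mul_nonneg (by linarith [n.cast_nonneg (α := ℝ)]) hz.le) (Complex.normSq_nonneg _)
    have h4 : 0 < ((n : ℝ) + 1 + 2 * lam) *
        (cgeg lam (n + 1 + 1) z * starRingEnd ℂ (cgeg lam (n + 1) z)).im :=
      mul_pos (by linarith [n.cast_nonneg (α := ℝ)]) ih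
    refine pos_of_mul_pos_right (a := (n : ℝ) + 1 + 2) ?_ (by positivity)
    rw [this]
    linarith

lemma cgeg_conj (m : ℕ) (z : ℂ) : cgeg lam m (starRingEnd ℂ z) = starRingEnd ℂ (cgeg lam m z) := by
  rw [cgeg, cgeg, hom_eval₂]
  congr 1
  ext x
  simp

lemma im_eq_zero_of_cgeg_eq_zero (h1 : -1 / 2 < lam) (h0 : lam ≠ 0) {n : ℕ} {z : ℂ}
    (hz : cgeg lam (n + 1) z = 0) : z.im = 0 := by
  by_contra hne
  wlog hpos : 0 < z.im generalizing z
  · refine this (z := starRingEnd ℂ z) (by rw [cgeg_conj, hz, map_zero]) (by simpa using hne) ?_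
    have := lt_of_le_of_ne (not_lt.mp hpos) hne
    simpa using this
  have := im_cgeg_mul_conj_pos h1 h0 hpos n
  rw [hz] at this
  simp at this

/-- A confluent Christoffel–Darboux argument: by the recurrence, each Wronskian is a square with
nonnegative weight plus a positive multiple of the previous Wronskian. A double zero would make it
vanish. -/
lemma wronskian_pos (h1 : -1 / 2 < lam) (h0 : lam ≠ 0) (x : ℝ) (n : ℕ) :
    0 < (derivative (gegenbauer lam (n + 2))).eval x * (gegenbauer lam (n + 1)).eval x
      - (derivative (gegenbauer lam (n + 1))).eval x * (gegenbauer lam (n + 2)).eval x := by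
  induction n with
  | zero =>
    have e1 := eval_gegenbauer_succ_succ lam 0 x
    have e2 := eval_derivative_gegenbauer_succ_succ lam 0 x
    rw [show gegenbauer lam (0 + 1) = C (2 * lam) * X from rfl,
      show gegenbauer lam 0 = 1 from rfl] at e1 e2
    rw [show gegenbauer lam (0 + 1) = C (2 * lam) * X from rfl]
    simp only [derivative_mul, derivative_C, derivative_X, eval_mul,
      eval_C, eval_X, eval_one, zero_mul, zero_add, mul_one, derivative_one, eval_zero,
      Nat.cast_zero] at e1 e2 ⊢
    have : 0 < lam ^ 2 := by positivity
    have : 0 ≤ (1 + lam) * (lam ^ 2 * x ^ 2) := mul_nonneg (by linarith) (by positivity)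
    refine pos_of_mul_pos_right (a := (2 : ℝ)) ?_ (by positivity)
    have : 2 * ((derivative (gegenbauer lam 2)).eval x * (2 * lam * x)
        - 2 * lam * (gegenbauer lam 2).eval x) = 8 * ((1 + lam) * (lam ^ 2 * x ^ 2)) + 4 * lam ^ 2 := by
      linear_combination (2 * lam * x) * e2 - 2 * lam * e1
    linarith
  | succ n ih =>
    have e1 := eval_gegenbauer_succ_succ lam (n + 1) x
    have e2 := eval_derivative_gegenbauer_succ_succ lam (n + 1) x
    push_cast at e1 e2
    have hn := n.cast_nonneg (α := ℝ)
    have h3 : 0 ≤ 2 * ((n : ℝ) + 1 + 1 + lam) * ((gegenbauer lam (n + 1 + 1)).eval x) ^ 2 :=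
      mul_nonneg (by linarith) (sq_nonneg _)
    have h4 := mul_pos (show 0 < (n : ℝ) + 1 + 2 * lam by linarith) ih
    refine pos_of_mul_pos_right (a := (n : ℝ) + 1 + 2) ?_ (by positivity)
    have : ((n : ℝ) + 1 + 2) *
        ((derivative (gegenbauer lam (n + 1 + 2))).eval x * (gegenbauer lam (n + 1 + 1)).eval x
        - (derivative (gegenbauer lam (n + 1 + 1))).eval x * (gegenbauer lam (n + 1 + 2)).eval x)
        = 2 * ((n : ℝ) + 1 + 1 + lam) * ((gegenbauer lam (n + 1 + 1)).eval x) ^ 2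
        + ((n : ℝ) + 1 + 2 * lam) *
        ((derivative (gegenbauer lam (n + 2))).eval x * (gegenbauer lam (n + 1)).eval x
        - (derivative (gegenbauer lam (n + 1))).eval x * (gegenbauer lam (n + 2)).eval x) := by
      linear_combination (gegenbauer lam (n + 1 + 1)).eval x * e2
        - (derivative (gegenbauer lam (n + 1 + 1))).eval x * e1
    rw [this]
    linarith

/-- Division by `2 lam` removes the sign of `lam`. The growth inequality, an equality at `x = 1`, is
the strengthening that carries positivity through the subtraction in the recurrence. -/
lemma eval_gegenbauer_div_pos (h1 : -1 / 2 < lam) (h0 : lam ≠ 0) {x : ℝ} (hx : 1 ≤ x) (n : ℕ) :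
    0 < (gegenbauer lam (n + 1)).eval x / (2 * lam) ∧
    ((n : ℝ) + 1 + 2 * lam) * ((gegenbauer lam (n + 1)).eval x / (2 * lam)) ≤
      ((n : ℝ) + 2) * ((gegenbauer lam (n + 2)).eval x / (2 * lam)) := by
  induction n with
  | zero =>
    have e1 := eval_gegenbauer_succ_succ lam 0 x
    simp only [gegenbauer, eval_mul, eval_C, eval_X, eval_one, Nat.cast_zero, zero_add] at e1 ⊢
    have e3 : 2 * lam * x / (2 * lam) = x := by field_simp
    rw [e3]
    refine ⟨by linarith, ?_⟩
    rw [mul_div_assoc', e1]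
    have : (2 * (1 + lam) * x * (2 * lam * x) - 2 * lam * 1) / (2 * lam)
        = 2 * (1 + lam) * x * x - 1 := by field_simp
    rw [this]
    nlinarith [mul_nonneg (sub_nonneg.2 hx) (show 0 ≤ 2 * (1 + lam) * x + 1 by nlinarith)]
  | succ n ih =>
    obtain ⟨h2, h3⟩ := ih
    have e1 := eval_gegenbauer_succ_succ lam (n + 1) x
    push_cast at e1 ⊢
    have hn := n.cast_nonneg (α := ℝ)
    have hpos : 0 < (gegenbauer lam (n + 2)).eval x / (2 * lam) := by
      refine pos_of_mul_pos_right (a := (n : ℝ) + 2) ?_ (by positivity)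
      exact lt_of_lt_of_le (mul_pos (by linarith) h2) h3
    refine ⟨hpos, ?_⟩
    have e2 : ((n : ℝ) + 1 + 2) * ((gegenbauer lam (n + 1 + 2)).eval x / (2 * lam)) =
      2 * (n + 1 + 1 + lam) * x * ((gegenbauer lam (n + 2)).eval x / (2 * lam))
        - (n + 1 + 2 * lam) * ((gegenbauer lam (n + 1)).eval x / (2 * lam)) := by
      rw [mul_div_assoc', e1]; ring
    rw [e2]
    have := mul_nonneg (mul_nonneg (show 0 ≤ 2 * ((n : ℝ) + 1 + 1 + lam) by linarith)
      (sub_nonneg.2 hx)) hpos.le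
    simp only [show n + 1 + 1 = n + 2 from rfl]
    linarith

lemma eval_gegenbauer_ne_zero (h1 : -1 / 2 < lam) (h0 : lam ≠ 0) (n : ℕ) {x : ℝ} (hx : 1 ≤ |x|) :
    (gegenbauer lam (n + 1)).eval x ≠ 0 := by
  wlog hpos : 0 ≤ x generalizing x
  · have := this (x := -x) (by simpa using hx) (by linarith)
    rw [eval_gegenbauer_neg] at this
    exact right_ne_zero_of_mul this
  rw [abs_of_nonneg hpos] at hx
  have := (eval_gegenbauer_div_pos h1 h0 hx n).1
  intro h
  simp [h] at this

lemma gegenbauer_ne_zero (h1 : -1 / 2 < lam) (h0 : lam ≠ 0) (n : ℕ) :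
    gegenbauer lam (n + 1) ≠ 0 := by
  intro h
  have := eval_gegenbauer_ne_zero h1 h0 n (x := 1) (by simp)
  simp [h] at this

lemma exists_mem_gaussPoints (h1 : -1 / 2 < lam) (h0 : lam ≠ 0) {n : ℕ} {z : ℂ}
    (hz : cgeg lam (n + 1) z = 0) : ∃ x ∈ gaussPoints lam n, (x : ℂ) = z := by
  refine ⟨z.re, ?_, ?_⟩
  · have hz' : z = (z.re : ℂ) := by
      apply Complex.ext <;> simp [im_eq_zero_of_cgeg_eq_zero h1 h0 hz]
    rw [hz', cgeg_ofReal] at hz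
    rw [gaussPoints, Multiset.mem_toFinset, mem_roots (gegenbauer_ne_zero h1 h0 n), IsRoot]
    exact_mod_cast hz
  · apply Complex.ext <;> simp [im_eq_zero_of_cgeg_eq_zero h1 h0 hz]

lemma abs_lt_one_of_mem_gaussPoints (h1 : -1 / 2 < lam) (h0 : lam ≠ 0) {n : ℕ} {x : ℝ}
    (hx : x ∈ gaussPoints lam n) : |x| < 1 := by
  by_contra h
  rw [gaussPoints, Multiset.mem_toFinset, mem_roots (gegenbauer_ne_zero h1 h0 n), IsRoot] at hx
  exact eval_gegenbauer_ne_zero h1 h0 n (not_lt.1 h) hx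

lemma cgeg_eq_zero_of_mem_gaussPoints {n : ℕ} {x : ℝ}
    (hx : x ∈ gaussPoints lam n) : cgeg lam (n + 1) x = 0 := by
  rw [gaussPoints, Multiset.mem_toFinset] at hx
  have := (isRoot_of_mem_roots hx)
  rw [cgeg_ofReal, this, Complex.ofReal_zero]

/-- Over `ℂ` the polynomial splits, and its roots are simple and real. This inequality is all that
interpolation needs, so the exact degree is never computed. -/
lemma natDegree_le_card_gaussPoints (h1 : -1 / 2 < lam) (h0 : lam ≠ 0) (n : ℕ) :
    ((gegenbauer lam (n + 1)).map Complex.ofRealHom).natDegree ≤ (gaussPoints lam n).card := by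
  set Q := (gegenbauer lam (n + 1)).map Complex.ofRealHom with hQ
  have hQ0 : Q ≠ 0 := (Polynomial.map_ne_zero_iff Complex.ofRealHom.injective).2
    (gegenbauer_ne_zero h1 h0 n)
  have hroot {z : ℂ} (hz : z ∈ Q.roots) : ∃ x ∈ gaussPoints lam n, (x : ℂ) = z := by
    apply exists_mem_gaussPoints h1 h0
    rw [cgeg_eq_eval_map]
    exact isRoot_of_mem_roots hz
  have hnodup : Q.roots.Nodup := by
    rw [Multiset.nodup_iff_count_le_one]
    intro z
    rw [count_roots]
    by_contra! hlt
    obtain ⟨hr, hd⟩ := (one_lt_rootMultiplicity_iff_isRoot hQ0).1 hlt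
    obtain ⟨x, -, rfl⟩ := hroot ((mem_roots hQ0).2 hr)
    have hr' : (gegenbauer lam (n + 1)).eval x = 0 := by
      have : cgeg lam (n + 1) x = 0 := by rw [cgeg_eq_eval_map]; exact hr
      rw [cgeg_ofReal] at this
      exact_mod_cast this
    have hd' : (derivative (gegenbauer lam (n + 1))).eval x = 0 := by
      have : (derivative Q).eval (x : ℂ) = 0 := hd
      rw [hQ, derivative_map, eval_map] at this
      have e := eval₂_at_apply (p := derivative (gegenbauer lam (n + 1))) Complex.ofRealHom x
      rw [Complex.ofRealHom_eq_coe, Complex.ofRealHom_eq_coe] at e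
      rw [this] at e
      exact_mod_cast e.symm
    -- `wronskian_pos` begins with the pair `C_1`, `C_2`, so simplicity of the zero of `C_1` is
    -- checked directly.
    cases n with
    | zero => simp [gegenbauer, h0] at hd'
    | succ m =>
      have := wronskian_pos h1 h0 x m
      rw [hr', hd'] at this
      simp at this
  have hcard : Q.natDegree = Q.roots.toFinset.card := by
    rw [Multiset.toFinset_card_of_nodup hnodup]
    exact (splits_iff_card_roots.1 (IsAlgClosed.splits Q)).symm
  rw [hcard]
  calc Q.roots.toFinset.card ≤ ((gaussPoints lam n).image (fun x : ℝ => (x : ℂ))).card := by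
        apply Finset.card_le_card
        intro z hz
        rw [Multiset.mem_toFinset] at hz
        simpa using hroot hz
    _ ≤ _ := Finset.card_image_le

end Zeros

/-- The Hermite kernel identity: interpolating `t ↦ 1 / (z - t)` at the Gauss points. -/
lemma sum_basis_div_sub {lam : ℝ} (h1 : -1 / 2 < lam) (h0 : lam ≠ 0) {n : ℕ} {x : ℝ} {z : ℂ}
    (hz : cgeg lam (n + 1) z ≠ 0) (hxz : z - x ≠ 0) :
    (z - x)⁻¹ - ∑ i ∈ gaussPoints lam n,
        (Lagrange.basis (gaussPoints lam n) (fun t : ℝ => (t : ℂ)) i).eval (x : ℂ) * (z - i)⁻¹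
      = cgeg lam (n + 1) x / (cgeg lam (n + 1) z * (z - x)) := by
  set Q := (gegenbauer lam (n + 1)).map Complex.ofRealHom with hQ
  set P := Q.eval z with hP
  have hPc (t : ℂ) : cgeg lam (n + 1) t = Q.eval t := cgeg_eq_eval_map _ _ _
  -- `R(t) = (Q(z) - Q(t)) / (z - t)` has degree below the number of nodes and equals `Q(z) / (z -
  -- i)` at each node `i`. So `R / Q(z)` is the interpolant of `1 / (z - t)`.
  obtain ⟨R, hR⟩ := X_sub_C_dvd_sub_C_eval (p := Q) (a := z)
  have hP0 : P ≠ 0 := by rwa [hP, ← hPc]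
  have hRe (t : ℂ) : Q.eval t - P = (t - z) * R.eval t := by
    have := congrArg (fun p => p.eval t) hR
    simpa using this
  have hRdeg : R.degree < (gaussPoints lam n).card := by
    rcases eq_or_ne R 0 with rfl | hR0
    · rw [degree_zero]; exact WithBot.bot_lt_coe _
    rw [degree_eq_natDegree hR0, Nat.cast_lt]
    have h2 : (Q - C P).natDegree = 1 + R.natDegree := by
      rw [hR, natDegree_mul (X_sub_C_ne_zero z) hR0, natDegree_X_sub_C]
    have h3 : (Q - C P).natDegree ≤ Q.natDegree := by simp [natDegree_sub_C]
    have h4 : Q.natDegree ≤ _ := natDegree_le_card_gaussPoints h1 h0 n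
    omega
  have hinj : Set.InjOn (fun t : ℝ => (t : ℂ)) (gaussPoints lam n) :=
    Complex.ofReal_injective.injOn
  have key := Lagrange.eq_interpolate_of_eval_eq (f := R)
    (r := fun i : ℝ => P * (z - i)⁻¹) hinj hRdeg (by
      intro i hi
      have h2 := hRe i
      have h3 := cgeg_eq_zero_of_mem_gaussPoints hi
      rw [hPc] at h3
      rw [h3] at h2
      have h4 : z - (i : ℂ) ≠ 0 := by
        intro h
        rw [sub_eq_zero] at h
        rw [h] at hP
        exact hP0 (hP.trans h3)
      field_simp
      linear_combination h2)
  have key2 := congrArg (fun p => p.eval (x : ℂ)) key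
  simp only [Lagrange.interpolate_apply, eval_finsetSum, eval_mul, eval_C] at key2
  have hsum : ∑ i ∈ gaussPoints lam n,
        (Lagrange.basis (gaussPoints lam n) (fun t : ℝ => (t : ℂ)) i).eval (x : ℂ) * (z - i)⁻¹
      = R.eval (x : ℂ) / P := by
    rw [key2, Finset.sum_div]
    refine Finset.sum_congr rfl fun i _ => ?_
    field_simp
  rw [hsum, hPc, hPc]
  have := hRe x
  rw [← hP]
  field_simp
  linear_combination -this

/-! ### The Joukowski parametrization of the ellipse -/

/-- The Joukowski map. -/
def joukowski (w : ℂ) : ℂ := (w + w⁻¹) / 2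

lemma joukowski_sub {w a : ℂ} (hw : w ≠ 0) (ha : a ≠ 0) :
    joukowski w - joukowski a = (w - a) * (w - a⁻¹) / (2 * w) := by
  unfold joukowski
  field_simp
  ring

lemma hasDerivAt_joukowski {w : ℂ} (hw : w ≠ 0) :
    HasDerivAt joukowski ((1 - (w ^ 2)⁻¹) / 2) w := by
  have h := ((hasDerivAt_id w).add (hasDerivAt_inv hw)).div_const 2
  rw [← sub_eq_add_neg] at h
  exact h

lemma exists_norm_one_joukowski {x : ℝ} (hx : x ∈ Set.Icc (-1 : ℝ) 1) :
    ∃ a : ℂ, ‖a‖ = 1 ∧ joukowski a = x := by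
  refine ⟨Complex.exp (Real.arccos x * Complex.I), Complex.norm_exp_ofReal_mul_I _, ?_⟩
  rw [joukowski, ← Complex.exp_neg, ← neg_mul, ← Complex.cos, ← Complex.ofReal_cos,
    Real.cos_arccos hx.1 hx.2]

lemma joukowski_re_im (ρ θ : ℝ) :
    (joukowski (circleMap 0 ρ θ)).re = (ρ + ρ⁻¹) / 2 * Real.cos θ ∧
    (joukowski (circleMap 0 ρ θ)).im = (ρ - ρ⁻¹) / 2 * Real.sin θ := by
  have h : joukowski (circleMap 0 ρ θ) = (((ρ + ρ⁻¹) / 2 * Real.cos θ : ℝ) : ℂ)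
      + (((ρ - ρ⁻¹) / 2 * Real.sin θ : ℝ) : ℂ) * Complex.I := by
    rw [joukowski, circleMap_zero, mul_inv, ← Complex.exp_neg, ← neg_mul, ← Complex.ofReal_neg,
      Complex.exp_mul_I, Complex.exp_mul_I]
    push_cast
    rw [Complex.cos_neg, Complex.sin_neg]
    ring
  rw [h]
  constructor
  · rw [Complex.add_re, Complex.ofReal_re, Complex.re_ofReal_mul, Complex.I_re, mul_zero, add_zero]
  · rw [Complex.add_im, Complex.ofReal_im, Complex.im_ofReal_mul, Complex.I_im, mul_one, zero_add]

lemma joukowski_mem_bernsteinEllipse {ρ : ℝ} {w : ℂ} (hw : ‖w‖ = ρ) :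
    joukowski w ∈ bernsteinEllipse ρ := by
  -- The argument lies in `(-π, π]`, so it is shifted by a multiple of `2π` into `[0, 2π)`.
  refine ⟨toIcoMod Real.two_pi_pos 0 w.arg, ?_, w, ?_, rfl⟩
  · have := toIcoMod_mem_Ico Real.two_pi_pos 0 w.arg
    rw [zero_add] at this
    exact ⟨this.1, this.2.le⟩
  · have h : Complex.exp ((toIcoMod Real.two_pi_pos 0 w.arg : ℝ) * Complex.I)
        = Complex.exp (w.arg * Complex.I) := by
      have e : toIcoMod Real.two_pi_pos 0 w.arg
          = w.arg - toIcoDiv Real.two_pi_pos 0 w.arg • (2 * Real.pi) := rfl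
      rw [e]
      push_cast
      rw [Complex.exp_eq_exp_iff_exists_int]
      refine ⟨-toIcoDiv Real.two_pi_pos 0 w.arg, ?_⟩
      simp
      ring
    rw [h, ← hw, Complex.norm_mul_exp_arg_mul_I]

lemma exists_joukowski_of_mem_bernsteinEllipse {ρ : ℝ} (hρ : 1 < ρ) {z : ℂ}
    (hz : z ∈ bernsteinEllipse ρ) : ∃ w, ‖w‖ = ρ ∧ joukowski w = z := by
  obtain ⟨θ, -, w, rfl, rfl⟩ := hz
  exact ⟨_, by rw [norm_mul, Complex.norm_exp_ofReal_mul_I, Complex.norm_real, mul_one,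
    Real.norm_of_nonneg (by linarith)], rfl⟩

/-! ### Contour integrals over the ellipse and Hermite's error formula -/

section Region

variable {ρ : ℝ}

lemma inv_lt_of_one_lt (hρ : 1 < ρ) : ρ⁻¹ < ρ := (inv_lt_one_of_one_lt₀ hρ).trans hρ

lemma joukowski_mem_ellipseRegion (hρ : 1 < ρ) {w : ℂ} (hw : ‖w‖ = ρ) :
    joukowski w ∈ ellipseRegion ρ := by
  have h : w = circleMap 0 ρ w.arg := by
    rw [circleMap_zero, ← hw, Complex.norm_mul_exp_arg_mul_I]
  rw [h]
  obtain ⟨h1, h2⟩ := joukowski_re_im ρ w.arg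
  have := inv_lt_of_one_lt hρ
  have : 0 < ρ⁻¹ := by positivity
  rw [ellipseRegion, Set.mem_ofPred_eq, h1, h2, mul_div_cancel_left₀ _ (by linarith),
    mul_div_cancel_left₀ _ (by linarith), Real.cos_sq_add_sin_sq]

lemma ofReal_mem_ellipseRegion (hρ : 1 < ρ) {x : ℝ} (hx : x ∈ Set.Icc (-1 : ℝ) 1) :
    (x : ℂ) ∈ ellipseRegion ρ := by
  have h0 : 0 < ρ⁻¹ := by positivity
  have h1 : 1 ≤ (ρ + ρ⁻¹) / 2 := by
    have : ρ * ρ⁻¹ = 1 := mul_inv_cancel₀ (by linarith)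
    nlinarith [sq_nonneg (ρ - ρ⁻¹)]
  rw [ellipseRegion, Set.mem_ofPred_eq]
  simp only [Complex.ofReal_re, Complex.ofReal_im, zero_div]
  rw [zero_pow two_ne_zero, add_zero, sq_le_one_iff_abs_le_one, abs_div,
    abs_of_pos (show 0 < (ρ + ρ⁻¹) / 2 by linarith), div_le_one (by linarith)]
  exact (abs_le.2 hx).trans h1

/-- Convexity passes to thickenings, where it provides primitives of holomorphic functions; no
deformation of contours is then needed. -/
lemma convex_ellipseRegion : Convex ℝ (ellipseRegion ρ) := by
  intro z hz w hw s t hs ht hst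
  simp only [ellipseRegion, Set.mem_ofPred_eq, Complex.add_re, Complex.real_smul, Complex.mul_re,
    Complex.add_im, Complex.mul_im, Complex.ofReal_re, Complex.ofReal_im, zero_mul, sub_zero,
    add_zero] at *
  have key (p q : ℝ) : (s * p + t * q) ^ 2 ≤ s * p ^ 2 + t * q ^ 2 := by
    have : s * p ^ 2 + t * q ^ 2 - (s * p + t * q) ^ 2 = s * t * (p - q) ^ 2 := by
      rw [← eq_sub_iff_add_eq] at hst
      rw [hst]; ring
    have h2 : 0 ≤ s * t * (p - q) ^ 2 := by positivity
    linarith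
  have k1 := key (z.re / ((ρ + ρ⁻¹) / 2)) (w.re / ((ρ + ρ⁻¹) / 2))
  have k2 := key (z.im / ((ρ - ρ⁻¹) / 2)) (w.im / ((ρ - ρ⁻¹) / 2))
  rw [add_div (s * z.re), add_div (s * z.im), mul_div_assoc, mul_div_assoc, mul_div_assoc,
    mul_div_assoc]
  nlinarith [mul_le_mul_of_nonneg_left hz hs, mul_le_mul_of_nonneg_left hw ht]

lemma isCompact_ellipseRegion (hρ : 1 < ρ) : IsCompact (ellipseRegion ρ) := by
  have := inv_lt_of_one_lt hρ
  have h0 : 0 < ρ⁻¹ := by positivity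
  refine Metric.isCompact_of_isClosed_isBounded ?_ ?_
  · apply isClosed_le
    · fun_prop
    · fun_prop
  · refine (Metric.isBounded_closedBall (x := (0 : ℂ)) (r := (ρ + ρ⁻¹) / 2 + (ρ - ρ⁻¹) / 2)).subset ?_
    intro z hz
    rw [ellipseRegion, Set.mem_ofPred_eq] at hz
    rw [mem_closedBall_zero_iff]
    refine (Complex.norm_le_abs_re_add_abs_im z).trans (add_le_add ?_ ?_)
    · have : (z.re / ((ρ + ρ⁻¹) / 2)) ^ 2 ≤ 1 := by
        linarith [sq_nonneg (z.im / ((ρ - ρ⁻¹) / 2))]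
      rwa [sq_le_one_iff_abs_le_one, abs_div, abs_of_pos (show 0 < (ρ + ρ⁻¹) / 2 by linarith),
        div_le_one (by linarith)] at this
    · have : (z.im / ((ρ - ρ⁻¹) / 2)) ^ 2 ≤ 1 := by
        linarith [sq_nonneg (z.re / ((ρ + ρ⁻¹) / 2))]
      rwa [sq_le_one_iff_abs_le_one, abs_div, abs_of_pos (show 0 < (ρ - ρ⁻¹) / 2 by linarith),
        div_le_one (by linarith)] at this

lemma norm_le_maxOnEllipse (hρ : 1 < ρ) {u : ℂ → ℂ} (hu : AnalyticOnNhd ℂ u (ellipseRegion ρ))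
    {w : ℂ} (hw : ‖w‖ = ρ) : ‖u (joukowski w)‖ ≤ maxOnEllipse ρ u := by
  apply le_csSup
  · refine ((isCompact_ellipseRegion hρ).bddAbove_image hu.continuousOn.norm).mono ?_
    apply Set.image_mono
    intro z hz
    obtain ⟨w, hw, rfl⟩ := exists_joukowski_of_mem_bernsteinEllipse hρ hz
    exact joukowski_mem_ellipseRegion hρ hw
  · exact ⟨_, joukowski_mem_bernsteinEllipse hw, rfl⟩

/-- Writing `x` as the Joukowski image of a unimodular `a`, the difference factors as `(w - a)(w -
a⁻¹) / (2w)`, and both factors in the numerator are at least `ρ - 1` in modulus. -/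
lemma le_norm_joukowski_sub (hρ : 1 < ρ) {w : ℂ} (hw : ‖w‖ = ρ) {x : ℝ}
    (hx : x ∈ Set.Icc (-1 : ℝ) 1) : (ρ - 1) ^ 2 / (2 * ρ) ≤ ‖joukowski w - x‖ := by
  obtain ⟨a, ha, hax⟩ := exists_norm_one_joukowski hx
  have ha0 : a ≠ 0 := by rintro rfl; simp at ha
  have hw0 : w ≠ 0 := by rintro rfl; rw [norm_zero] at hw; linarith
  rw [← hax, joukowski_sub hw0 ha0, norm_div, norm_mul, norm_mul, hw, Complex.norm_two]
  have h1 := norm_sub_norm_le w a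
  have h2 := norm_sub_norm_le w a⁻¹
  rw [norm_inv, ha, inv_one, hw] at h2
  rw [ha, hw] at h1
  gcongr
  rw [sq]
  exact mul_le_mul h1 h2 (by linarith) (norm_nonneg _)

lemma joukowski_sub_ne_zero (hρ : 1 < ρ) {w : ℂ} (hw : ‖w‖ = ρ) {x : ℝ}
    (hx : x ∈ Set.Icc (-1 : ℝ) 1) : joukowski w - x ≠ 0 := by
  rw [← norm_pos_iff]
  refine lt_of_lt_of_le ?_ (le_norm_joukowski_sub hρ hw hx)
  have : 0 < ρ - 1 := by linarith
  positivity

lemma ne_zero_of_mem_sphere (hρ : 1 < ρ) {w : ℂ} (hw : w ∈ Metric.sphere (0 : ℂ) ρ) : w ≠ 0 := by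
  rintro rfl
  simp at hw
  linarith

lemma continuousOn_joukowski_sphere (hρ : 1 < ρ) :
    ContinuousOn joukowski (Metric.sphere (0 : ℂ) ρ) :=
  fun _ hw => (hasDerivAt_joukowski (ne_zero_of_mem_sphere hρ hw)).continuousAt.continuousWithinAt

lemma circleIntegrable_joukowski (hρ : 1 < ρ) {f : ℂ → ℂ} (hf : ContinuousOn f (ellipseRegion ρ))
    {x : ℝ} (hx : x ∈ Set.Icc (-1 : ℝ) 1) :
    CircleIntegrable (fun w => f (joukowski w) * (joukowski w - x)⁻¹ * ((1 - (w ^ 2)⁻¹) / 2))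
      0 ρ := by
  apply ContinuousOn.circleIntegrable (by linarith)
  have hJ := continuousOn_joukowski_sphere hρ
  refine ((hf.comp hJ ?_).mul ((hJ.sub continuousOn_const).inv₀ ?_)).mul ?_
  · intro w hw
    exact joukowski_mem_ellipseRegion hρ (by simpa using hw)
  · intro w hw
    exact joukowski_sub_ne_zero hρ (by simpa using hw) hx
  · refine ((continuousOn_const).sub (ContinuousOn.inv₀ (by fun_prop) ?_)).div_const 2
    intro w hw
    exact pow_ne_zero 2 (ne_zero_of_mem_sphere hρ hw)

/-- The integrand is the logarithmic derivative of `(w - a)(w - a⁻¹) / w`, that is `(w - a)⁻¹ + (w -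
a⁻¹)⁻¹ - w⁻¹`. All three poles are inside the circle, with residues `1 + 1 - 1 = 1`. -/
lemma circleIntegral_joukowski_sub_inv (hρ : 1 < ρ) {x : ℝ} (hx : x ∈ Set.Icc (-1 : ℝ) 1) :
    (∮ w in C(0, ρ), (joukowski w - x)⁻¹ * ((1 - (w ^ 2)⁻¹) / 2)) = 2 * Real.pi * Complex.I := by
  obtain ⟨a, ha, hax⟩ := exists_norm_one_joukowski hx
  have ha0 : a ≠ 0 := by rintro rfl; simp at ha
  have mem {b : ℂ} (hb : ‖b‖ < ρ) : b ∈ Metric.ball (0 : ℂ) ρ := by simpa using hb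
  have hint {b : ℂ} (hb : ‖b‖ < ρ) : CircleIntegrable (fun w => (w - b)⁻¹) 0 ρ := by
    apply ContinuousOn.circleIntegrable (by linarith)
    refine ContinuousOn.inv₀ (by fun_prop) ?_
    intro w hw h
    rw [sub_eq_zero] at h
    rw [mem_sphere_zero_iff_norm, h] at hw
    linarith
  have hai : ‖a⁻¹‖ < ρ := by rw [norm_inv, ha, inv_one]; exact hρ
  have ha1 : ‖a‖ < ρ := by rw [ha]; exact hρ
  have h0 : ‖(0 : ℂ)‖ < ρ := by rw [norm_zero]; linarith
  have e : (∮ w in C(0, ρ), (joukowski w - x)⁻¹ * ((1 - (w ^ 2)⁻¹) / 2))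
      = ∮ w in C(0, ρ), ((w - a)⁻¹ + (w - a⁻¹)⁻¹) - (w - 0)⁻¹ := by
    refine circleIntegral.integral_congr (by linarith) fun w hw => ?_
    have hw0 := ne_zero_of_mem_sphere hρ hw
    have hne := joukowski_sub_ne_zero hρ (by simpa using hw) hx
    rw [← hax, joukowski_sub hw0 ha0] at hne
    have h1 : w - a ≠ 0 := by rintro h; simp [h] at hne
    have h2 : w - a⁻¹ ≠ 0 := by rintro h; simp [h] at hne
    rw [← hax, joukowski_sub hw0 ha0, sub_zero]
    have h3 : a * a⁻¹ = 1 := mul_inv_cancel₀ ha0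
    generalize a⁻¹ = b at *
    field_simp
    linear_combination h3
  rw [e, circleIntegral.integral_sub ((hint ha1).fun_add (hint hai)) (hint h0),
    circleIntegral.integral_add (hint ha1) (hint hai),
    circleIntegral.integral_sub_inv_of_mem_ball (mem ha1),
    circleIntegral.integral_sub_inv_of_mem_ball (mem hai),
    circleIntegral.integral_sub_inv_of_mem_ball (mem h0)]
  ring

/-- Cauchy's integral formula on the Bernstein ellipse, parametrized by the Joukowski map. -/
lemma circleIntegral_joukowski_cauchy (hρ : 1 < ρ) {u : ℂ → ℂ}
    (hu : AnalyticOnNhd ℂ u (ellipseRegion ρ)) {x : ℝ} (hx : x ∈ Set.Icc (-1 : ℝ) 1) :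
    (∮ w in C(0, ρ), u (joukowski w) * (joukowski w - x)⁻¹ * ((1 - (w ^ 2)⁻¹) / 2))
      = 2 * Real.pi * Complex.I * u x := by
  obtain ⟨δ, hδ, hsub⟩ := (isCompact_ellipseRegion hρ).exists_thickening_subset_open
    (isOpen_analyticAt ℂ u) hu
  set U := Metric.thickening δ (ellipseRegion ρ) with hU
  have hUo : IsOpen U := Metric.isOpen_thickening
  have hEU : ellipseRegion ρ ⊆ U := Metric.self_subset_thickening hδ _
  -- The difference quotient of `u` at `x` is holomorphic across `x`, so it has a primitive `g` on
  -- the convex set `U`. Then `g ∘ joukowski` is a primitive along the circle and the integral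
  -- vanishes.
  have hd : DifferentiableOn ℂ (dslope u x) U := by
    rw [Complex.differentiableOn_dslope (hUo.mem_nhds (hEU (ofReal_mem_ellipseRegion hρ hx)))]
    exact fun z hz => (hsub hz).differentiableAt.differentiableWithinAt
  obtain ⟨g, hg⟩ := (convex_ellipseRegion.thickening δ).exists_forall_hasDerivWithinAt hd
  have hz : (∮ w in C(0, ρ), dslope u x (joukowski w) * ((1 - (w ^ 2)⁻¹) / 2)) = 0 := by
    apply circleIntegral.integral_eq_zero_of_hasDerivWithinAt (f := g ∘ joukowski) (by linarith)
    intro w hw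
    have hm : joukowski w ∈ U := hEU (joukowski_mem_ellipseRegion hρ (by simpa using hw))
    exact (((hg _ hm).hasDerivAt (hUo.mem_nhds hm)).comp w
      (hasDerivAt_joukowski (ne_zero_of_mem_sphere hρ hw))).hasDerivWithinAt
  have e : (∮ w in C(0, ρ), dslope u x (joukowski w) * ((1 - (w ^ 2)⁻¹) / 2))
      = ∮ w in C(0, ρ), u (joukowski w) * (joukowski w - x)⁻¹ * ((1 - (w ^ 2)⁻¹) / 2)
        - u x * (joukowski w - x)⁻¹ * ((1 - (w ^ 2)⁻¹) / 2) := by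
    refine circleIntegral.integral_congr (by linarith) fun w hw => ?_
    have hne := joukowski_sub_ne_zero hρ (by simpa using hw) hx
    rw [dslope_of_ne _ (sub_ne_zero.1 hne), slope_def_field]
    ring
  rw [e, circleIntegral.integral_sub (circleIntegrable_joukowski hρ hu.continuousOn hx)
    (circleIntegrable_joukowski (f := fun _ => u x) hρ continuousOn_const hx)] at hz
  simp_rw [mul_assoc (u x)] at hz
  rw [circleIntegral.integral_const_mul, circleIntegral_joukowski_sub_inv hρ hx] at hz
  linear_combination hz

/-- Hermite's contour integral formula for the interpolation error. -/
lemma hermite_formula {lam : ℝ} (h1 : -1 / 2 < lam) (h0 : lam ≠ 0) (hρ : 1 < ρ) {u : ℂ → ℂ}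
    (hu : AnalyticOnNhd ℂ u (ellipseRegion ρ)) (n : ℕ)
    (hne : ∀ w : ℂ, ‖w‖ = ρ → cgeg lam (n + 1) (joukowski w) ≠ 0)
    {x : ℝ} (hx : x ∈ Set.Icc (-1 : ℝ) 1) :
    2 * Real.pi * Complex.I * (u x - (interpolant lam n u).eval (x : ℂ)) =
      ∮ w in C(0, ρ), u (joukowski w) * (cgeg lam (n + 1) x /
        (cgeg lam (n + 1) (joukowski w) * (joukowski w - x))) * ((1 - (w ^ 2)⁻¹) / 2) := by
  have hmem {i : ℝ} (hi : i ∈ gaussPoints lam n) : i ∈ Set.Icc (-1 : ℝ) 1 :=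
    abs_le.1 (abs_lt_one_of_mem_gaussPoints h1 h0 hi).le
  set l : ℝ → ℂ := fun i =>
    (Lagrange.basis (gaussPoints lam n) (fun t : ℝ => (t : ℂ)) i).eval (x : ℂ) with hl
  -- The kernel identity splits the integrand into Cauchy kernels at `x` and at the nodes.
  have e : (∮ w in C(0, ρ), u (joukowski w) * (cgeg lam (n + 1) x /
        (cgeg lam (n + 1) (joukowski w) * (joukowski w - x))) * ((1 - (w ^ 2)⁻¹) / 2))
      = ∮ w in C(0, ρ), u (joukowski w) * (joukowski w - x)⁻¹ * ((1 - (w ^ 2)⁻¹) / 2)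
        - ∑ i ∈ gaussPoints lam n,
          l i * (u (joukowski w) * (joukowski w - i)⁻¹ * ((1 - (w ^ 2)⁻¹) / 2)) := by
    refine circleIntegral.integral_congr (by linarith) fun w hw => ?_
    have hw' : ‖w‖ = ρ := by simpa using hw
    rw [← sum_basis_div_sub h1 h0 (hne w hw') (joukowski_sub_ne_zero hρ hw' hx), mul_sub, sub_mul,
      Finset.mul_sum, Finset.sum_mul]
    congr 1
    refine Finset.sum_congr rfl fun i _ => ?_
    simp only [hl]
    ring
  have hI {i : ℝ} (hi : i ∈ Set.Icc (-1 : ℝ) 1) := circleIntegrable_joukowski hρ hu.continuousOn hi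
  rw [e, circleIntegral.integral_sub (hI hx), circleIntegral_joukowski_cauchy hρ hu hx,
    circleIntegral.integral_fun_sum]
  · rw [mul_sub]
    congr 1
    rw [interpolant, Lagrange.interpolate_apply, eval_finsetSum, Finset.mul_sum]
    refine Finset.sum_congr rfl fun i hi => ?_
    rw [circleIntegral.integral_const_mul, circleIntegral_joukowski_cauchy hρ hu (hmem hi)]
    simp only [eval_mul, eval_C, hl]
    ring
  · intro i hi
    exact (hI (hmem hi)).const_fun_smul (a := l i)
  · exact CircleIntegrable.fun_sum _ fun i hi => (hI (hmem hi)).const_fun_smul (a := l i)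

/-- With `S² = ρ² + ρ⁻²`, the speed `q` along the ellipse satisfies `q² = (S² - 2 cos 2θ) / 4`, and
`(q - S/2)² ≥ 0` linearizes the square root. The cosine term integrates to zero over a period, which
leaves the length bound `π S`. -/
lemma mul_norm_deriv_joukowski_le (hρ : 1 < ρ) (θ : ℝ) :
    ρ * ‖(1 - ((circleMap 0 ρ θ) ^ 2)⁻¹) / 2‖ ≤
      Real.sqrt (ρ ^ 2 + ρ ^ (-2 : ℤ)) / 2
        - Real.cos (2 * θ) / (2 * Real.sqrt (ρ ^ 2 + ρ ^ (-2 : ℤ))) := by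
  have hρ0 : 0 < ρ := by linarith
  have hA : 0 < ρ ^ 2 + ρ ^ (-2 : ℤ) := by positivity
  set S := Real.sqrt (ρ ^ 2 + ρ ^ (-2 : ℤ)) with hS
  have hS0 : 0 < S := Real.sqrt_pos.2 hA
  have hS2 : S ^ 2 = ρ ^ 2 + ρ ^ (-2 : ℤ) := Real.sq_sqrt hA.le
  have hz : ρ ^ (-2 : ℤ) = (ρ ^ 2)⁻¹ := by rw [zpow_neg]; norm_cast
  rw [hz] at hS2
  set q := ρ * ‖(1 - ((circleMap 0 ρ θ) ^ 2)⁻¹) / 2‖ with hq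
  have hq2 : q ^ 2 = (S ^ 2 - 2 * Real.cos (2 * θ)) / 4 := by
    have e : (circleMap 0 ρ θ ^ 2)⁻¹ =
        (((ρ ^ 2)⁻¹ * Real.cos (2 * θ) : ℝ) : ℂ)
        + ((-((ρ ^ 2)⁻¹ * Real.sin (2 * θ)) : ℝ) : ℂ) * Complex.I := by
      rw [circleMap_zero, mul_pow, ← Complex.exp_nat_mul, mul_inv, ← Complex.exp_neg]
      rw [show -(((2 : ℕ) : ℂ) * ((θ : ℂ) * Complex.I)) = ((-(2 * θ) : ℝ) : ℂ) * Complex.I by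
        push_cast; ring, Complex.exp_mul_I, ← Complex.ofReal_cos, ← Complex.ofReal_sin,
        Real.cos_neg, Real.sin_neg]
      push_cast
      ring
    rw [hq, mul_pow, ← Complex.normSq_eq_norm_sq, e, Complex.normSq_apply, hS2]
    have hc := Real.sin_sq_add_cos_sq (2 * θ)
    generalize Real.sin (2 * θ) = s at *
    generalize Real.cos (2 * θ) = c at *
    simp only [Complex.sub_re, Complex.sub_im, Complex.div_ofNat_re, Complex.div_ofNat_im,
      Complex.add_re, Complex.add_im, Complex.ofReal_re, Complex.ofReal_im, Complex.re_ofReal_mul,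
      Complex.im_ofReal_mul, Complex.I_re, Complex.I_im, Complex.one_re, Complex.one_im]
    field_simp
    have : s ^ 2 = 1 - c ^ 2 := by linarith
    ring_nf
    rw [this]
    ring
  rw [div_sub_div _ _ two_ne_zero (by positivity), le_div_iff₀ (by positivity)]
  nlinarith [sq_nonneg (q - S / 2)]

lemma norm_circleIntegral_joukowski_le (hρ : 1 < ρ) {f : ℂ → ℂ} {K : ℝ} (hK : 0 ≤ K)
    (hf : ∀ w : ℂ, ‖w‖ = ρ → ‖f w‖ ≤ K) :
    ‖∮ w in C(0, ρ), f w * ((1 - (w ^ 2)⁻¹) / 2)‖ ≤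
      K * (Real.pi * Real.sqrt (ρ ^ 2 + ρ ^ (-2 : ℤ))) := by
  set S := Real.sqrt (ρ ^ 2 + ρ ^ (-2 : ℤ)) with hS
  have hint : IntervalIntegrable (fun θ : ℝ => K * (S / 2 - Real.cos (2 * θ) / (2 * S)))
      MeasureTheory.volume 0 (2 * Real.pi) := by
    apply Continuous.intervalIntegrable
    fun_prop
  have := intervalIntegral.norm_integral_le_of_norm_le (μ := MeasureTheory.volume)
    (f := fun θ => deriv (circleMap 0 ρ) θ •
      (f (circleMap 0 ρ θ) * ((1 - ((circleMap 0 ρ θ) ^ 2)⁻¹) / 2)))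
    Real.two_pi_pos.le (Filter.Eventually.of_forall fun θ _ => ?_) hint
  · refine this.trans (le_of_eq ?_)
    rw [intervalIntegral.integral_const_mul, intervalIntegral.integral_sub (by simp)
      (Continuous.intervalIntegrable (by fun_prop) _ _), intervalIntegral.integral_const,
      intervalIntegral.integral_div, intervalIntegral.integral_comp_mul_left _ two_ne_zero,
      integral_cos]
    have : Real.sin (2 * (2 * Real.pi)) = 0 := by
      have := Real.sin_nat_mul_pi 4
      rw [← this]; congr 1; push_cast; ring
    simp only [this, mul_zero, Real.sin_zero, sub_zero, zero_div, smul_eq_mul]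
    ring
  · have hn : ‖circleMap 0 ρ θ‖ = ρ := by rw [norm_circleMap_zero, abs_of_pos (by linarith)]
    rw [norm_smul, deriv_circleMap, norm_mul, norm_mul, Complex.norm_I, mul_one, hn]
    calc ρ * (‖f (circleMap 0 ρ θ)‖ * ‖(1 - ((circleMap 0 ρ θ) ^ 2)⁻¹) / 2‖)
        = ‖f (circleMap 0 ρ θ)‖ * (ρ * ‖(1 - ((circleMap 0 ρ θ) ^ 2)⁻¹) / 2‖) := by ring
      _ ≤ K * (S / 2 - Real.cos (2 * θ) / (2 * S)) :=
        mul_le_mul (hf _ hn) (mul_norm_deriv_joukowski_le hρ θ) (by positivity) hK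

/-- The interpolation error in terms of the node polynomial on `[-1, 1]` and on the ellipse. -/
lemma norm_sub_interpolant_le {lam : ℝ} (h1 : -1 / 2 < lam) (h0 : lam ≠ 0) (hρ : 1 < ρ) {u : ℂ → ℂ}
    (hu : AnalyticOnNhd ℂ u (ellipseRegion ρ)) (n : ℕ) {m A : ℝ} (hm : 0 < m)
    (hmle : ∀ w : ℂ, ‖w‖ = ρ → m ≤ ‖cgeg lam (n + 1) (joukowski w)‖)
    (hA : ∀ x ∈ Set.Icc (-1 : ℝ) 1, |(gegenbauer lam (n + 1)).eval x| ≤ A)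
    {x : ℝ} (hx : x ∈ Set.Icc (-1 : ℝ) 1) :
    ‖u x - (interpolant lam n u).eval (x : ℂ)‖ ≤
      maxOnEllipse ρ u * Real.sqrt (ρ ^ 2 + ρ ^ (-2 : ℤ)) / (ρ - 1) ^ 2 * (ρ * A / m) := by
  have hρ0 : 0 < ρ := by linarith
  have hρ1 : 0 < ρ - 1 := by linarith
  have hne (w : ℂ) (hw : ‖w‖ = ρ) : cgeg lam (n + 1) (joukowski w) ≠ 0 :=
    norm_pos_iff.1 (hm.trans_le (hmle w hw))
  have hH := hermite_formula h1 h0 hρ hu n hne hx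
  have hM : 0 ≤ maxOnEllipse ρ u := (norm_nonneg _).trans
    (norm_le_maxOnEllipse hρ hu (w := ρ) (by simp [abs_of_pos hρ0]))
  have hA0 : 0 ≤ A := (abs_nonneg _).trans (hA x hx)
  have hb := norm_circleIntegral_joukowski_le hρ
    (f := fun w => u (joukowski w) * (cgeg lam (n + 1) x /
        (cgeg lam (n + 1) (joukowski w) * (joukowski w - x))))
    (K := maxOnEllipse ρ u * (A / (m * ((ρ - 1) ^ 2 / (2 * ρ))))) (by positivity) (by
      intro w hw
      rw [norm_mul, norm_div, norm_mul]
      gcongr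
      · exact norm_le_maxOnEllipse hρ hu hw
      · rw [cgeg_ofReal, Complex.norm_real]
        exact hA x hx
      · exact hmle w hw
      · exact le_norm_joukowski_sub hρ hw hx)
  rw [← hH, norm_mul] at hb
  have hpi : ‖(2 * Real.pi * Complex.I : ℂ)‖ = 2 * Real.pi := by
    simp [abs_of_pos Real.pi_pos]
  rw [hpi] at hb
  have h2 := Real.two_pi_pos
  rw [← mul_le_mul_iff_right₀ h2]
  refine hb.trans (le_of_eq ?_)
  field_simp

end Region

/-! ### Binomial coefficients and their Gamma asymptotics -/

/-- The coefficients `(lam)_k / k!` of the binomial series of `(1 - t) ^ (-lam)`. -/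
def binomCoeff (lam : ℝ) (k : ℕ) : ℝ := (ascPochhammer ℝ k).eval lam / k.factorial

section BinomCoeff

variable (lam : ℝ)

@[simp] lemma binomCoeff_zero : binomCoeff lam 0 = 1 := by simp [binomCoeff]

lemma succ_mul_binomCoeff_succ (k : ℕ) :
    ((k : ℝ) + 1) * binomCoeff lam (k + 1) = (lam + k) * binomCoeff lam k := by
  rw [binomCoeff, binomCoeff, ascPochhammer_succ_eval, Nat.factorial_succ]
  have : (k.factorial : ℝ) ≠ 0 := by exact_mod_cast k.factorial_ne_zero
  push_cast
  field_simp

lemma binomCoeff_pos {lam : ℝ} (h : 0 < lam) (k : ℕ) : 0 < binomCoeff lam k :=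
  div_pos (ascPochhammer_pos k lam h) (by exact_mod_cast k.factorial_pos)

variable {lam}

lemma binomCoeff_ne_zero (h : ∀ m : ℕ, lam + m ≠ 0) (k : ℕ) : binomCoeff lam k ≠ 0 := by
  induction k with
  | zero => simp
  | succ k ih =>
    have h1 := succ_mul_binomCoeff_succ lam k
    intro h2
    rw [h2, mul_zero] at h1
    exact mul_ne_zero (h k) ih h1.symm

lemma prod_range_add_eq (n : ℕ) : ∏ j ∈ Finset.range (n + 1), (lam + j) =
    n.factorial * binomCoeff lam n * (lam + n) := by
  have h (n : ℕ) : ∏ j ∈ Finset.range n, (lam + j) = n.factorial * binomCoeff lam n := by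
    have : (n.factorial : ℝ) ≠ 0 := by exact_mod_cast n.factorial_ne_zero
    rw [binomCoeff, mul_div_cancel₀ _ this]
    induction n with
    | zero => simp
    | succ n ih =>
      rw [Finset.prod_range_succ, ih (by exact_mod_cast n.factorial_ne_zero),
        ascPochhammer_succ_eval]
  rw [Finset.prod_range_succ, h]

lemma add_ne_zero_of_neg_half_lt (h1 : -1 / 2 < lam) (h0 : lam ≠ 0) (m : ℕ) : lam + m ≠ 0 := by
  rcases m with _ | m
  · simpa using h0
  · push_cast
    have := m.cast_nonneg (α := ℝ)
    intro h
    linarith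

lemma tendsto_natCast_div_add : Tendsto (fun n : ℕ => (n : ℝ) / (lam + n)) atTop (𝓝 1) := by
  have h := (tendsto_natCast_div_add_atTop lam : Tendsto (fun n : ℕ => (n : ℝ) / (n + lam)) _ _)
  simpa only [add_comm] using h

/-- This is the Gauss product for `Γ`: `GammaSeq lam n` equals `n^lam / (g_n (lam + n))`. The
hypothesis keeps `lam` away from the poles. -/
lemma tendsto_binomCoeff_mul_rpow (h : ∀ m : ℕ, lam + m ≠ 0) :
    Tendsto (fun n : ℕ => binomCoeff lam n * (n : ℝ) ^ (1 - lam)) atTop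
      (𝓝 (Real.Gamma lam)⁻¹) := by
  have hG : Real.Gamma lam ≠ 0 := Real.Gamma_ne_zero fun m hm => h m (by rw [hm]; ring)
  have h1 := (tendsto_natCast_div_add (lam := lam)).mul
    ((Real.GammaSeq_tendsto_Gamma lam).inv₀ hG)
  rw [one_mul] at h1
  refine h1.congr' ?_
  filter_upwards [eventually_gt_atTop 0] with n hn
  have hn' : (0 : ℝ) < n := by exact_mod_cast hn
  have hf : (n.factorial : ℝ) ≠ 0 := by exact_mod_cast n.factorial_ne_zero
  rw [Real.GammaSeq, prod_range_add_eq, Real.rpow_sub hn', Real.rpow_one]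
  have := h n
  have := binomCoeff_ne_zero h n
  have := (Real.rpow_pos_of_pos hn' lam).ne'
  field_simp

lemma tendsto_binomCoeff_div_succ (h : ∀ m : ℕ, lam + m ≠ 0) :
    Tendsto (fun n => binomCoeff lam n / binomCoeff lam (n + 1)) atTop (𝓝 1) := by
  have h1 := (tendsto_natCast_div_add (lam := lam)).div
    (tendsto_natCast_div_add (lam := 1)) one_ne_zero
  rw [div_one] at h1
  refine h1.congr' ?_
  filter_upwards [eventually_gt_atTop 0] with n hn
  have hn' : (n : ℝ) ≠ 0 := by exact_mod_cast hn.ne'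
  have h2 := binomCoeff_ne_zero h (n + 1)
  have h3 := h n
  have h4 : (1 : ℝ) + n ≠ 0 := by positivity
  have h5 := succ_mul_binomCoeff_succ lam n
  simp only [Pi.div_apply]
  field_simp
  linear_combination h5

end BinomCoeff

/-! ### Expansion of `C_m` in the Joukowski variable -/

section Expansion

variable (lam : ℝ)

/-- This is `(1 - 2zt + t²)^{-lam} = (1 - wt)^{-lam} (1 - t/w)^{-lam}` read in formal power series.
Each factor satisfies `(1 - wt) A' = lam w A` (with `w⁻¹` for the second), and the resulting
equation for the product is the Gegenbauer recurrence on coefficients. -/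
lemma cgeg_joukowski {w : ℂ} (hw : w ≠ 0) (m : ℕ) :
    cgeg lam m (joukowski w) = ∑ p ∈ Finset.HasAntidiagonal.antidiagonal m,
      ((binomCoeff lam p.1 : ℂ) * w ^ p.1) * ((binomCoeff lam p.2 : ℂ) * (w⁻¹) ^ p.2) := by
  let A (w : ℂ) : PowerSeries ℂ := PowerSeries.mk fun k => (binomCoeff lam k : ℂ) * w ^ k
  have hA (w : ℂ) : (1 - PowerSeries.C w * PowerSeries.X) * PowerSeries.derivative ℂ (A w)
      = PowerSeries.C (lam * w) * A w := by
    ext n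
    have e := succ_mul_binomCoeff_succ lam n
    have e' : ((n : ℂ) + 1) * binomCoeff lam (n + 1) = (lam + n) * binomCoeff lam n := by
      exact_mod_cast e
    rw [sub_mul, one_mul, mul_assoc, map_sub, PowerSeries.coeff_C_mul, PowerSeries.coeff_C_mul,
      PowerSeries.coeff_derivative]
    have hX : PowerSeries.coeff n (PowerSeries.X * PowerSeries.derivative ℂ (A w)) =
        n * (binomCoeff lam n * w ^ n) := by
      cases n with
      | zero => simp
      | succ n =>
        rw [PowerSeries.coeff_succ_X_mul, PowerSeries.coeff_derivative]
        simp [A]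
        ring
    rw [hX]
    simp only [A, PowerSeries.coeff_mk]
    linear_combination w ^ (n + 1) * e'
  set F := A w * A w⁻¹ with hF
  set z := joukowski w with hz
  have hode : (1 - PowerSeries.C (2 * z) * PowerSeries.X + PowerSeries.X * PowerSeries.X)
      * PowerSeries.derivative ℂ F = (PowerSeries.C (2 * lam * z)
        - PowerSeries.C (2 * (lam : ℂ)) * PowerSeries.X) * F := by
    have h1 : PowerSeries.derivative ℂ F = A w * PowerSeries.derivative ℂ (A w⁻¹)
        + A w⁻¹ * PowerSeries.derivative ℂ (A w) := by
      rw [hF, Derivation.leibniz]; rfl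
    have h2 := hA w
    have h3 := hA w⁻¹
    have h4 : (PowerSeries.C w * PowerSeries.C w⁻¹ : PowerSeries ℂ) = 1 := by
      rw [← map_mul, mul_inv_cancel₀ hw, map_one]
    have h5 : (PowerSeries.C (2 * z) : PowerSeries ℂ) = PowerSeries.C w + PowerSeries.C w⁻¹ := by
      rw [← map_add, hz, joukowski]; congr 1; ring
    have h6 : (PowerSeries.C (2 * lam * z) : PowerSeries ℂ)
        = PowerSeries.C (lam : ℂ) * (PowerSeries.C w + PowerSeries.C w⁻¹) := by
      rw [← map_add, ← map_mul, hz, joukowski]; congr 1; ring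
    have h7 : (PowerSeries.C (2 * (lam : ℂ)) : PowerSeries ℂ) = 2 * PowerSeries.C (lam : ℂ) := by
      rw [map_mul]; rfl
    rw [map_mul] at h2 h3
    rw [h5, h6, h7, h1, hF]
    generalize PowerSeries.C w = c at *
    generalize PowerSeries.C w⁻¹ = d at *
    generalize PowerSeries.derivative ℂ (A w) = a' at *
    generalize PowerSeries.derivative ℂ (A w⁻¹) = b' at *
    generalize (PowerSeries.X : PowerSeries ℂ) = X at *
    generalize A w = a at *
    generalize A w⁻¹ = b at *
    generalize PowerSeries.C (lam : ℂ) = l at *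
    linear_combination b * (1 - d * X) * h2 + a * (1 - c * X) * h3
      - (X * X * (a * b' + b * a') + 2 * l * X * a * b) * h4
  have hcoeff (m : ℕ) : PowerSeries.coeff m F = ∑ p ∈ Finset.HasAntidiagonal.antidiagonal m,
      ((binomCoeff lam p.1 : ℂ) * w ^ p.1) * ((binomCoeff lam p.2 : ℂ) * (w⁻¹) ^ p.2) := by
    rw [hF, PowerSeries.coeff_mul]
    simp only [A, PowerSeries.coeff_mk]
  have hrec (n : ℕ) : ((n : ℂ) + 2) * PowerSeries.coeff (n + 2) F =
      2 * (n + 1 + lam) * z * PowerSeries.coeff (n + 1) F - (n + 2 * lam) * PowerSeries.coeff n F := by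
    have e := congrArg (PowerSeries.coeff (n + 1)) hode
    have hX : PowerSeries.coeff n (PowerSeries.X * PowerSeries.derivative ℂ F) =
        n * PowerSeries.coeff n F := by
      cases n with
      | zero => simp
      | succ n =>
        rw [PowerSeries.coeff_succ_X_mul, PowerSeries.coeff_derivative]
        push_cast
        ring
    rw [add_mul, sub_mul, sub_mul, one_mul, mul_assoc (PowerSeries.C (2 * z)),
      mul_assoc PowerSeries.X, mul_assoc (PowerSeries.C (2 * (lam : ℂ))), map_add, map_sub, map_sub, PowerSeries.coeff_C_mul, PowerSeries.coeff_C_mul, PowerSeries.coeff_C_mul,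
      PowerSeries.coeff_succ_X_mul, PowerSeries.coeff_succ_X_mul, PowerSeries.coeff_succ_X_mul, hX,
      PowerSeries.coeff_derivative, PowerSeries.coeff_derivative] at e
    push_cast at e
    linear_combination e
  rw [← hcoeff]
  induction m using Nat.twoStepInduction with
  | zero => rw [hcoeff]; simp [cgeg_zero]
  | one =>
    rw [hcoeff, cgeg_one, hz, joukowski]
    have := succ_mul_binomCoeff_succ lam 0
    have h1 : binomCoeff lam 1 = lam := by simpa using this
    rw [Finset.Nat.antidiagonal_succ]
    simp [h1]
    ring
  | more n ih1 ih2 =>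
    have h : ((n : ℂ) + 2) ≠ 0 := by exact_mod_cast (show n + 2 ≠ 0 by omega)
    apply mul_left_cancel₀ h
    rw [cgeg_succ_succ, hrec, ih1, ih2]

lemma eval_gegenbauer_one (m : ℕ) : (gegenbauer lam m).eval 1 = binomCoeff (2 * lam) m := by
  induction m using Nat.twoStepInduction with
  | zero => simp [gegenbauer]
  | one =>
    have := succ_mul_binomCoeff_succ (2 * lam) 0
    simpa [gegenbauer] using this.symm
  | more n ih1 ih2 =>
    have h : ((n : ℝ) + 2) ≠ 0 := by positivity
    apply mul_left_cancel₀ h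
    rw [eval_gegenbauer_succ_succ, ih1, ih2]
    have e1 := succ_mul_binomCoeff_succ (2 * lam) n
    have e2 := succ_mul_binomCoeff_succ (2 * lam) (n + 1)
    push_cast at e2
    linear_combination e1 - e2

lemma abs_eval_gegenbauer_le (m : ℕ) {x : ℝ} (hx : x ∈ Set.Icc (-1 : ℝ) 1) :
    |(gegenbauer lam m).eval x| ≤
      ∑ p ∈ Finset.HasAntidiagonal.antidiagonal m, |binomCoeff lam p.1| * |binomCoeff lam p.2| := by
  obtain ⟨a, ha, hax⟩ := exists_norm_one_joukowski hx
  have ha0 : a ≠ 0 := by rintro rfl; simp at ha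
  rw [← Real.norm_eq_abs, ← Complex.norm_real, ← cgeg_ofReal, ← hax, cgeg_joukowski lam ha0]
  refine (norm_sum_le _ _).trans (le_of_eq (Finset.sum_congr rfl fun p _ => ?_))
  simp [ha]

/-- All coefficients `g_k` are positive, so the triangle inequality over `|w| = 1` is an equality at
`w = 1`, that is at `x = 1`. -/
lemma abs_eval_gegenbauer_le_of_pos {lam : ℝ} (h : 0 < lam) (m : ℕ) {x : ℝ}
    (hx : x ∈ Set.Icc (-1 : ℝ) 1) :
    |(gegenbauer lam m).eval x| ≤ binomCoeff (2 * lam) m := by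
  refine (abs_eval_gegenbauer_le lam m hx).trans (le_of_eq ?_)
  have e := cgeg_joukowski lam one_ne_zero m
  rw [show joukowski 1 = ((1 : ℝ) : ℂ) by norm_num [joukowski], cgeg_ofReal,
    eval_gegenbauer_one] at e
  simp only [one_pow, inv_one, mul_one] at e
  rw [show binomCoeff (2 * lam) m = ∑ p ∈ Finset.HasAntidiagonal.antidiagonal m,
    binomCoeff lam p.1 * binomCoeff lam p.2 by exact_mod_cast e]
  refine Finset.sum_congr rfl fun p _ => ?_
  rw [abs_of_pos (binomCoeff_pos h _), abs_of_pos (binomCoeff_pos h _)]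

end Expansion

/-! ### Uniform asymptotics of `C_m` on the ellipse -/

section Series

variable {lam : ℝ}

lemma hasSum_binomCoeff (lam : ℝ) {t : ℂ} (ht : ‖t‖ < 1) :
    HasSum (fun k => (binomCoeff lam k : ℂ) * t ^ k) (1 / (1 - t) ^ (lam : ℂ)) := by
  have h := (Complex.one_div_one_sub_cpow_hasFPowerSeriesOnBall_zero lam).hasSum (y := t) (by
    rw [← ENNReal.ofReal_one, Metric.eball_ofReal]; simpa using ht)
  simp only [FormalMultilinearSeries.ofScalars_apply_eq, zero_add] at h
  refine (funext fun k => ?_ : (fun k => (binomCoeff lam k : ℂ) * t ^ k) =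
    fun k : ℕ => Ring.choose ((lam : ℂ) + k - 1) k • t ^ k) ▸ h
  rw [← Ring.multichoose_eq, smul_eq_mul]
  congr 1
  have e := Ring.factorial_nsmul_multichoose_eq_ascPochhammer (lam : ℂ) k
  rw [Polynomial.ascPochhammer_smeval_eq_eval, nsmul_eq_mul] at e
  have hf : (k.factorial : ℂ) ≠ 0 := by exact_mod_cast k.factorial_ne_zero
  have hm : (((ascPochhammer ℝ k).eval lam : ℝ) : ℂ) = (ascPochhammer ℂ k).eval (lam : ℂ) := by
    rw [← ascPochhammer_map Complex.ofRealHom, eval_map]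
    exact (eval₂_at_apply Complex.ofRealHom lam).symm
  rw [binomCoeff, Complex.ofReal_div, hm, ← e]
  push_cast
  field_simp

lemma norm_tsum_binomCoeff (lam : ℝ) {t : ℂ} (ht : ‖t‖ < 1) :
    ‖∑' k, (binomCoeff lam k : ℂ) * t ^ k‖ = ‖1 - t‖ ^ (-lam) := by
  rw [(hasSum_binomCoeff lam ht).tsum_eq, norm_div, Complex.norm_cpow_real, norm_one,
    Real.rpow_neg (norm_nonneg _), one_div]

lemma summable_abs_binomCoeff_mul_pow {r : ℝ} (hr0 : 0 < r)
    (hr : r < 1) : Summable fun k => |binomCoeff lam k| * r ^ k := by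
  have := (hasSum_binomCoeff lam (t := r) (by simpa [abs_of_pos hr0] using hr)).summable.norm
  simpa [abs_of_pos hr0] using this

lemma tendsto_binomCoeff_sub_div (h : ∀ m : ℕ, lam + m ≠ 0) (k : ℕ) :
    Tendsto (fun m => binomCoeff lam (m - k) / binomCoeff lam m) atTop (𝓝 1) := by
  rw [← tendsto_add_atTop_iff_nat k]
  simp only [Nat.add_sub_cancel]
  induction k with
  | zero => simp [binomCoeff_ne_zero h]
  | succ k ih =>
    have h2 := ih.mul ((tendsto_add_atTop_iff_nat k).2 (tendsto_binomCoeff_div_succ h))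
    rw [one_mul] at h2
    refine h2.congr fun m => ?_
    have := binomCoeff_ne_zero h (m + k)
    rw [div_mul_div_cancel₀ this]
    rfl

lemma exists_le_mul_of_eventually_le_succ {s : ℕ → ℝ} (hs : ∀ n, 0 < s n)
    (hmono : ∀ᶠ n in atTop, s n ≤ s (n + 1)) : ∃ K, 0 < K ∧ ∀ j m, j ≤ m → s j ≤ K * s m := by
  obtain ⟨N, hN⟩ := eventually_atTop.1 hmono
  have hNm {j m : ℕ} (hj : N ≤ j) (hjm : j ≤ m) : s j ≤ s m := by
    induction m, hjm using Nat.le_induction with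
    | base => exact le_rfl
    | succ m hm ih => exact ih.trans (hN m (hj.trans hm))
  -- For indices up to `N`, the sum `a` dominates every term and the sum `b` of reciprocals every
  -- inverse, so `s i ≤ a ≤ a b s j`.
  set a := ∑ i ∈ Finset.range (N + 1), s i with ha
  set b := ∑ i ∈ Finset.range (N + 1), (s i)⁻¹ with hb
  have hsa {i : ℕ} (hi : i ≤ N) : s i ≤ a :=
    Finset.single_le_sum (f := s) (fun i _ => (hs i).le) (Finset.mem_range.2 (by omega))
  have hsb {i : ℕ} (hi : i ≤ N) : 1 ≤ b * s i := by
    have : (s i)⁻¹ ≤ b := Finset.single_le_sum (f := fun i => (s i)⁻¹)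
      (fun i _ => (inv_pos.2 (hs i)).le) (Finset.mem_range.2 (by omega))
    have h2 := mul_le_mul_of_nonneg_right this (hs i).le
    rwa [inv_mul_cancel₀ (hs i).ne'] at h2
  have ha0 : 0 < a := (hs 0).trans_le (hsa (Nat.zero_le _))
  have key {i j : ℕ} (hi : i ≤ N) (hj : j ≤ N) : s i ≤ a * b * s j := by
    calc s i ≤ a := hsa hi
      _ = a * 1 := by ring
      _ ≤ a * (b * s j) := by gcongr; exact hsb hj
      _ = a * b * s j := by ring
  have hab : 1 ≤ a * b := by
    have := key (le_refl N) (le_refl N)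
    exact (le_mul_iff_one_le_left (hs N)).1 this
  refine ⟨a * b, by linarith, fun j m hjm => ?_⟩
  rcases le_total m N with hm | hm
  · exact key (hjm.trans hm) hm
  · rcases le_total j N with hj | hj
    · refine (key hj le_rfl).trans ?_
      gcongr
      exact hNm le_rfl hm
    · exact (hNm hj hjm).trans (le_mul_of_one_le_left (hs m).le hab)

/-- Consecutive ratios tend to `1 < ρ`, so `|g_n| ρ^n` is eventually increasing. The growth `ρ^k`
allowed here is absorbed by the weight `ρ^{-2k}` of the expansion, leaving a summable majorant. -/
lemma exists_abs_binomCoeff_div_le (h : ∀ m : ℕ, lam + m ≠ 0) {ρ : ℝ} (hρ : 1 < ρ) :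
    ∃ K, 0 < K ∧ ∀ k m, k ≤ m → |binomCoeff lam (m - k) / binomCoeff lam m| ≤ K * ρ ^ k := by
  have hρ0 : 0 < ρ := by linarith
  obtain ⟨K, hK, hle⟩ := exists_le_mul_of_eventually_le_succ
    (s := fun n => |binomCoeff lam n| * ρ ^ n)
    (fun n => mul_pos (abs_pos.2 (binomCoeff_ne_zero h n)) (by positivity)) (by
      have h1 := (tendsto_binomCoeff_div_succ h).abs
      rw [abs_one] at h1
      filter_upwards [h1.eventually_lt_const hρ] with n hn
      rw [abs_div, div_lt_iff₀ (abs_pos.2 (binomCoeff_ne_zero h _))] at hn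
      calc |binomCoeff lam n| * ρ ^ n ≤ (ρ * |binomCoeff lam (n + 1)|) * ρ ^ n := by gcongr
        _ = _ := by ring)
  refine ⟨K, hK, fun k m hkm => ?_⟩
  have h1 := hle (m - k) m (Nat.sub_le _ _)
  have h2 : ρ ^ m = ρ ^ (m - k) * ρ ^ k := by rw [← pow_add]; congr 1; omega
  rw [h2] at h1
  rw [abs_div, div_le_iff₀ (abs_pos.2 (binomCoeff_ne_zero h _))]
  have h3 : 0 < ρ ^ (m - k) := by positivity
  refine le_of_mul_le_mul_right ?_ h3
  linarith

/-- The normalized coefficients of `C_m` in the Joukowski variable. -/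
def coeffRatio (lam : ℝ) (m k : ℕ) : ℝ :=
  if k ≤ m then binomCoeff lam (m - k) / binomCoeff lam m else 0

/-- The uniform distance, on `|w| = ρ`, between `C_m / (g_m w ^ m)` and its limit. -/
def expansionError (lam ρ : ℝ) (m : ℕ) : ℝ :=
  ∑' k, |binomCoeff lam k| * |coeffRatio lam m k - 1| * ((ρ ^ 2)⁻¹) ^ k

lemma exists_expansionError_bound (h : ∀ m : ℕ, lam + m ≠ 0) {ρ : ℝ} (hρ : 1 < ρ) :
    ∃ K, 0 < K ∧ ∀ m k, |binomCoeff lam k| * |coeffRatio lam m k - 1| * ((ρ ^ 2)⁻¹) ^ k ≤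
      K * (|binomCoeff lam k| * (ρ⁻¹) ^ k) := by
  have hρ0 : 0 < ρ := by linarith
  obtain ⟨K, hK, hle⟩ := exists_abs_binomCoeff_div_le h hρ
  refine ⟨K + 1, by linarith, fun m k => ?_⟩
  have h1 : |coeffRatio lam m k - 1| ≤ (K + 1) * ρ ^ k := by
    refine (abs_sub _ _).trans ?_
    have h3 : 1 ≤ ρ ^ k := one_le_pow₀ hρ.le
    have h2 : |coeffRatio lam m k| ≤ K * ρ ^ k := by
      unfold coeffRatio
      split_ifs with hkm
      · exact hle k m hkm
      · rw [abs_zero]; positivity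
    rw [abs_one]
    linarith
  calc |binomCoeff lam k| * |coeffRatio lam m k - 1| * ((ρ ^ 2)⁻¹) ^ k
      ≤ |binomCoeff lam k| * ((K + 1) * ρ ^ k) * ((ρ ^ 2)⁻¹) ^ k := by gcongr
    _ = (K + 1) * (|binomCoeff lam k| * (ρ⁻¹) ^ k) := by
      rw [inv_pow, inv_pow, ← pow_mul, mul_comm 2 k, pow_mul, sq]
      field_simp

/-- Dominated convergence for series: each coefficient ratio tends to `1` for fixed `k`, under the
majorant uniform in `m`. -/
lemma tendsto_expansionError (h : ∀ m : ℕ, lam + m ≠ 0) {ρ : ℝ} (hρ : 1 < ρ) :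
    Tendsto (expansionError lam ρ) atTop (𝓝 0) := by
  obtain ⟨K, hK, hle⟩ := exists_expansionError_bound h hρ
  have := tendsto_tsum_of_dominated_convergence (𝓕 := atTop)
    (f := fun m k => |binomCoeff lam k| * |coeffRatio lam m k - 1| * ((ρ ^ 2)⁻¹) ^ k)
    (g := fun _ => (0 : ℝ))
    ((summable_abs_binomCoeff_mul_pow (lam := lam) (r := ρ⁻¹) (by positivity)
      (inv_lt_one_of_one_lt₀ hρ)).mul_left K) ?_ ?_
  · rwa [tsum_zero] at this
  · intro k
    have h1 : Tendsto (fun m => coeffRatio lam m k) atTop (𝓝 1) := by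
      refine (tendsto_binomCoeff_sub_div h k).congr' ?_
      filter_upwards [eventually_ge_atTop k] with m hm
      rw [coeffRatio, if_pos hm]
    have h2 := ((h1.sub_const 1).abs.const_mul |binomCoeff lam k|).mul_const (((ρ ^ 2)⁻¹) ^ k)
    simpa using h2
  · refine Eventually.of_forall fun m k => ?_
    rw [Real.norm_of_nonneg (by positivity)]
    exact hle m k

lemma le_norm_cgeg_joukowski (h : ∀ m : ℕ, lam + m ≠ 0) {ρ : ℝ} (hρ : 1 < ρ) (m : ℕ) {w : ℂ}
    (hw : ‖w‖ = ρ) :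
    |binomCoeff lam m| * ρ ^ m * (‖1 - (w ^ 2)⁻¹‖ ^ (-lam) - expansionError lam ρ m) ≤
      ‖cgeg lam m (joukowski w)‖ := by
  have hρ0 : 0 < ρ := by linarith
  have hw0 : w ≠ 0 := by rintro rfl; rw [norm_zero] at hw; linarith
  have hg := binomCoeff_ne_zero h m
  have ht : ‖(w ^ 2)⁻¹‖ = (ρ ^ 2)⁻¹ := by rw [norm_inv, norm_pow, hw]
  have ht1 : ‖(w ^ 2)⁻¹‖ < 1 := by
    rw [ht]
    exact inv_lt_one_of_one_lt₀ (one_lt_pow₀ hρ two_ne_zero)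
  -- The sum is read downwards from its top power: `k` counts the factors `w⁻¹`, so the term is
  -- `g_{m-k} g_k w^{m-2k}`. Terms with `k > m` vanish by the default value of `coeffRatio`.
  have hfin : cgeg lam m (joukowski w) = binomCoeff lam m * w ^ m *
      ∑' k, (binomCoeff lam k : ℂ) * (coeffRatio lam m k : ℂ) * ((w ^ 2)⁻¹) ^ k := by
    rw [tsum_eq_sum (s := Finset.range (m + 1)), cgeg_joukowski lam hw0,
      ← Finset.Nat.sum_antidiagonal_swap,
      Finset.Nat.sum_antidiagonal_eq_sum_range_succ_mk, Finset.mul_sum]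
    · refine Finset.sum_congr rfl fun k hk => ?_
      have hkm : k ≤ m := by simpa [Nat.lt_succ_iff] using hk
      have hg' : (binomCoeff lam m : ℂ) ≠ 0 := by exact_mod_cast hg
      have e : w ^ m = w ^ (m - k) * w ^ k := by rw [← pow_add]; congr 1; omega
      simp only [Prod.fst_swap, Prod.snd_swap, coeffRatio, if_pos hkm, e, inv_pow, ← pow_mul,
        Complex.ofReal_div, mul_comm 2 k]
      rw [pow_mul]
      field_simp
    · intro k hk
      have hkm : ¬ k ≤ m := by simpa [Nat.lt_succ_iff] using hk
      simp [coeffRatio, hkm]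
  obtain ⟨K, hK, hle⟩ := exists_expansionError_bound h hρ
  have hsumE : Summable fun k => |binomCoeff lam k| * |coeffRatio lam m k - 1| * ((ρ ^ 2)⁻¹) ^ k :=
    Summable.of_nonneg_of_le (fun k => by positivity) (hle m)
      ((summable_abs_binomCoeff_mul_pow (lam := lam) (r := ρ⁻¹) (by positivity)
      (inv_lt_one_of_one_lt₀ hρ)).mul_left K)
  have hnorm (k : ℕ) : ‖(binomCoeff lam k : ℂ) * ((coeffRatio lam m k : ℂ) - 1) * ((w ^ 2)⁻¹) ^ k‖
      = |binomCoeff lam k| * |coeffRatio lam m k - 1| * ((ρ ^ 2)⁻¹) ^ k := by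
    rw [norm_mul, norm_mul, norm_pow, ht, ← Complex.ofReal_one, ← Complex.ofReal_sub,
      Complex.norm_real, Complex.norm_real, Real.norm_eq_abs, Real.norm_eq_abs]
  have hsumE' : Summable fun k =>
      (binomCoeff lam k : ℂ) * ((coeffRatio lam m k : ℂ) - 1) * ((w ^ 2)⁻¹) ^ k :=
    Summable.of_norm (by simpa only [hnorm] using hsumE)
  have hsumG := (hasSum_binomCoeff lam ht1).summable
  have hsplit : ∑' k, (binomCoeff lam k : ℂ) * (coeffRatio lam m k : ℂ) * ((w ^ 2)⁻¹) ^ k =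
      ∑' k, (binomCoeff lam k : ℂ) * ((w ^ 2)⁻¹) ^ k +
      ∑' k, (binomCoeff lam k : ℂ) * ((coeffRatio lam m k : ℂ) - 1) * ((w ^ 2)⁻¹) ^ k := by
    rw [← hsumG.tsum_add hsumE']
    exact tsum_congr fun k => by ring
  have herr : ‖∑' k, (binomCoeff lam k : ℂ) * ((coeffRatio lam m k : ℂ) - 1) * ((w ^ 2)⁻¹) ^ k‖
      ≤ expansionError lam ρ m := by
    refine (norm_tsum_le_tsum_norm (by simpa only [hnorm] using hsumE)).trans (le_of_eq ?_)
    exact tsum_congr hnorm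
  rw [hfin, norm_mul, norm_mul, norm_pow, hw, Complex.norm_real, Real.norm_eq_abs, hsplit]
  gcongr
  rw [← norm_tsum_binomCoeff lam ht1]
  have := norm_sub_le_norm_add (∑' k, (binomCoeff lam k : ℂ) * ((w ^ 2)⁻¹) ^ k)
    (∑' k, (binomCoeff lam k : ℂ) * ((coeffRatio lam m k : ℂ) - 1) * ((w ^ 2)⁻¹) ^ k)
  linarith

end Series

/-! ### Existence of a Szegő constant for negative `lam` -/

section Szego

variable {lam : ℝ}

lemma exists_abs_binomCoeff_le (h : ∀ m : ℕ, lam + m ≠ 0) :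
    ∃ B, 0 < B ∧ ∀ n : ℕ, 0 < n → |binomCoeff lam n| ≤ B * (n : ℝ) ^ (lam - 1) := by
  obtain ⟨B, hB⟩ := (tendsto_binomCoeff_mul_rpow h).abs.bddAbove_range
  refine ⟨max B 1, by positivity, fun n hn => ?_⟩
  have hn' : (0 : ℝ) < n := by exact_mod_cast hn
  have h1 : |binomCoeff lam n * (n : ℝ) ^ (1 - lam)| ≤ max B 1 :=
    (hB (Set.mem_range_self n)).trans (le_max_left _ _)
  rw [abs_mul, abs_of_pos (Real.rpow_pos_of_pos hn' _)] at h1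
  rw [show lam - 1 = -(1 - lam) by ring, Real.rpow_neg hn'.le, ← div_eq_mul_inv,
    le_div_iff₀ (Real.rpow_pos_of_pos hn' _)]
  exact h1

lemma summable_abs_binomCoeff (h : ∀ m : ℕ, lam + m ≠ 0) (hneg : lam < 0) :
    Summable fun k => |binomCoeff lam k| := by
  obtain ⟨B, hB, hle⟩ := exists_abs_binomCoeff_le h
  have hs : Summable fun k : ℕ => B * (k : ℝ) ^ (lam - 1) :=
    (Real.summable_nat_rpow.2 (by linarith)).mul_left B
  rw [← summable_nat_add_iff 1] at hs ⊢
  exact Summable.of_nonneg_of_le (fun k => abs_nonneg _) (fun k => hle _ (Nat.succ_pos k)) hs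

/-- In each product `g_j g_k` with `j + k = m`, one index is at least `m/2` and its coefficient is
`O(m^{lam-1})`; the other coefficients are absolutely summable because `lam < 0`. -/
lemma exists_isSzegoConstant (h1 : -1 / 2 < lam) (hneg : lam < 0) :
    ∃ D : ℝ, IsSzegoConstant lam D := by
  have h := add_ne_zero_of_neg_half_lt h1 hneg.ne
  obtain ⟨B, hB, hle⟩ := exists_abs_binomCoeff_le h
  have hS := summable_abs_binomCoeff h hneg
  set S := ∑' k, |binomCoeff lam k| with hSdef
  have hS1 : 1 ≤ S := by
    have := hS.le_tsum 0 (fun k _ => abs_nonneg _)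
    simpa using this
  have h2 : (0 : ℝ) < (1 / 2) ^ (lam - 1) := by positivity
  -- The power of `1/2` comes from replacing the larger index by `m/2`, and `S + S` from the two
  -- choices of that index.
  refine ⟨B * (1 / 2) ^ (lam - 1) * (S + S), by positivity, ?_⟩
  filter_upwards [eventually_gt_atTop 0] with m hm x hx
  have hm' : (0 : ℝ) < m := by exact_mod_cast hm
  have hhalf {j : ℕ} (hj : m ≤ 2 * j) :
      |binomCoeff lam j| ≤ B * ((1 / 2) ^ (lam - 1) * (m : ℝ) ^ (lam - 1)) := by
    refine (hle j (by omega)).trans ?_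
    rw [← Real.mul_rpow (by norm_num) hm'.le]
    gcongr 1
    refine Real.rpow_le_rpow_of_nonpos (by positivity) ?_ (by linarith)
    have : (m : ℝ) ≤ 2 * j := by exact_mod_cast hj
    linarith
  set T := B * ((1 / 2) ^ (lam - 1) * (m : ℝ) ^ (lam - 1)) with hT
  have hT0 : 0 ≤ T := by positivity
  have hpart : ∑ p ∈ Finset.HasAntidiagonal.antidiagonal m, |binomCoeff lam p.1| ≤ S := by
    rw [Finset.Nat.sum_antidiagonal_eq_sum_range_succ (fun i _ => |binomCoeff lam i|)]
    exact hS.sum_le_tsum _ fun k _ => abs_nonneg _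
  have hpart' : ∑ p ∈ Finset.HasAntidiagonal.antidiagonal m, |binomCoeff lam p.2| ≤ S := by
    rw [← Finset.Nat.sum_antidiagonal_swap]
    exact hpart
  calc |(gegenbauer lam m).eval x|
      ≤ ∑ p ∈ Finset.HasAntidiagonal.antidiagonal m, |binomCoeff lam p.1| * |binomCoeff lam p.2| :=
        abs_eval_gegenbauer_le lam m hx
    _ ≤ ∑ p ∈ Finset.HasAntidiagonal.antidiagonal m, T * (|binomCoeff lam p.1| + |binomCoeff lam p.2|) := by
      refine Finset.sum_le_sum fun p hp => ?_
      rw [Finset.HasAntidiagonal.mem_antidiagonal] at hp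
      rcases le_total m (2 * p.1) with hc | hc
      · have := mul_le_mul_of_nonneg_right (hhalf hc) (abs_nonneg (binomCoeff lam p.2))
        have := mul_nonneg hT0 (abs_nonneg (binomCoeff lam p.1))
        linarith
      · have := mul_le_mul_of_nonneg_left (hhalf (j := p.2) (by omega))
          (abs_nonneg (binomCoeff lam p.1))
        have := mul_nonneg hT0 (abs_nonneg (binomCoeff lam p.2))
        linarith
    _ = T * (∑ p ∈ Finset.HasAntidiagonal.antidiagonal m, |binomCoeff lam p.1|
        + ∑ p ∈ Finset.HasAntidiagonal.antidiagonal m, |binomCoeff lam p.2|) := by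
      rw [← Finset.sum_add_distrib, Finset.mul_sum]
    _ ≤ T * (S + S) := by gcongr
    _ = B * (1 / 2) ^ (lam - 1) * (S + S) * (m : ℝ) ^ (lam - 1) := by rw [hT]; ring

end Szego

/-! ### Assembly of the error constants -/

section ErrorConstants

variable {lam ρ : ℝ}

lemma cgeg_joukowski_ne_zero (h1 : -1 / 2 < lam) (h0 : lam ≠ 0) (hρ : 1 < ρ) (n : ℕ) {w : ℂ}
    (hw : ‖w‖ = ρ) : cgeg lam (n + 1) (joukowski w) ≠ 0 := by
  intro hz
  obtain ⟨x, hx, hxz⟩ := exists_mem_gaussPoints h1 h0 hz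
  have := joukowski_sub_ne_zero hρ hw (abs_le.1 (abs_lt_one_of_mem_gaussPoints h1 h0 hx).le)
  rw [hxz, sub_self] at this
  exact this rfl

lemma exists_pos_le_norm_cgeg_joukowski (h1 : -1 / 2 < lam) (h0 : lam ≠ 0) (hρ : 1 < ρ) (n : ℕ) :
    ∃ m : ℝ, 0 < m ∧ ∀ w : ℂ, ‖w‖ = ρ → m ≤ ‖cgeg lam (n + 1) (joukowski w)‖ := by
  have hcont : ContinuousOn (fun w => ‖cgeg lam (n + 1) (joukowski w)‖)
      (Metric.sphere (0 : ℂ) ρ) := by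
    simp_rw [cgeg_eq_eval_map]
    exact ((Polynomial.continuous _).comp_continuousOn (continuousOn_joukowski_sphere hρ)).norm
  obtain ⟨w₀, hw₀, hmin⟩ := (isCompact_sphere (0 : ℂ) ρ).exists_isMinOn
    (NormedSpace.sphere_nonempty.2 (by linarith)) hcont
  exact ⟨_, norm_pos_iff.2 (cgeg_joukowski_ne_zero h1 h0 hρ n (by simpa using hw₀)),
    fun w hw => hmin (by simpa using hw)⟩

lemma exists_abs_eval_gegenbauer_le (lam : ℝ) (m : ℕ) :
    ∃ A : ℝ, ∀ x ∈ Set.Icc (-1 : ℝ) 1, |(gegenbauer lam m).eval x| ≤ A :=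
  ⟨_, fun _ hx => abs_eval_gegenbauer_le lam m hx⟩

/-- Asymptotically sharp error constants from a sup bound `a n` for `C_{n+1}` on `[-1, 1]`. -/
lemma exists_error_constants (h1 : -1 / 2 < lam) (h0 : lam ≠ 0) (hρ : 1 < ρ) {L : ℝ} (hL : 0 < L)
    (hLle : ∀ w : ℂ, ‖w‖ = ρ → L ≤ ‖1 - (w ^ 2)⁻¹‖ ^ (-lam)) {a b : ℕ → ℝ} {N : ℕ}
    (hb : ∀ n, N ≤ n → 0 < b n)
    (ha : ∀ᶠ n in atTop, ∀ x ∈ Set.Icc (-1 : ℝ) 1, |(gegenbauer lam (n + 1)).eval x| ≤ a n)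
    (hlim : Tendsto (fun n => a n / (|binomCoeff lam (n + 1)| * b n)) atTop (𝓝 1)) :
    ∃ c : ℕ → ℝ, (∀ n, 0 < c n) ∧ Tendsto c atTop (𝓝 1) ∧
      ∀ u : ℂ → ℂ, AnalyticOnNhd ℂ u (ellipseRegion ρ) →
        ∀ n : ℕ, N ≤ n → ∀ x ∈ Set.Icc (-1 : ℝ) 1,
          ‖u (x : ℂ) - (interpolant lam n u).eval (x : ℂ)‖ ≤
            c n * (maxOnEllipse ρ u * Real.sqrt (ρ ^ 2 + ρ ^ (-2 : ℤ)) / ((ρ - 1) ^ 2 * L)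
              * (b n / ρ ^ n)) := by
  classical
  have hρ0 : 0 < ρ := by linarith
  have hρ1 : 0 < ρ - 1 := by linarith
  have hg := add_ne_zero_of_neg_half_lt h1 h0
  set δ := expansionError lam ρ with hδ
  -- The quotient of the asymptotic error bound by the target. The factor `ρ` from the distance
  -- estimate turns `ρ^{n+1}` into `ρ^n`.
  set s : ℕ → ℝ := fun n => a n / (|binomCoeff lam (n + 1)| * b n) * (L / (L - δ (n + 1))) with hs
  let P (n : ℕ) (r : ℝ) : Prop := 0 < r ∧ ∀ u : ℂ → ℂ, AnalyticOnNhd ℂ u (ellipseRegion ρ) →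
    ∀ x ∈ Set.Icc (-1 : ℝ) 1, ‖u (x : ℂ) - (interpolant lam n u).eval (x : ℂ)‖ ≤
      r * (maxOnEllipse ρ u * Real.sqrt (ρ ^ 2 + ρ ^ (-2 : ℤ)) / ((ρ - 1) ^ 2 * L)
        * (b n / ρ ^ n))
  have hM {u : ℂ → ℂ} (hu : AnalyticOnNhd ℂ u (ellipseRegion ρ)) : 0 ≤ maxOnEllipse ρ u :=
    (norm_nonneg _).trans (norm_le_maxOnEllipse hρ hu (w := ρ) (by simp [abs_of_pos hρ0]))
  -- Fallback for small `n`: since `C_{n+1}` has no zero on the ellipse, compactness yields some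
  -- finite constant valid for every `u`.
  have hex (n : ℕ) : ∃ r, 0 < r ∧ (N ≤ n → P n r) := by
    by_cases hn : N ≤ n
    · obtain ⟨m, hm, hmle⟩ := exists_pos_le_norm_cgeg_joukowski h1 h0 hρ n
      obtain ⟨A, hA⟩ := exists_abs_eval_gegenbauer_le lam (n + 1)
      have hA' : ∀ x ∈ Set.Icc (-1 : ℝ) 1, |(gegenbauer lam (n + 1)).eval x| ≤ max A 1 :=
        fun x hx => (hA x hx).trans (le_max_left _ _)
      have hbn := hb n hn
      have hr : 0 < ρ * max A 1 / m * L * ρ ^ n / b n := by positivity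
      refine ⟨_, hr, fun _ => ⟨hr, fun u hu x hx => ?_⟩⟩
      refine (norm_sub_interpolant_le h1 h0 hρ hu n hm hmle hA' hx).trans (le_of_eq ?_)
      field_simp
    · exact ⟨1, one_pos, fun h => absurd h hn⟩
  choose r hr0 hrP using hex
  have hδlim : Tendsto (fun n => δ (n + 1)) atTop (𝓝 0) :=
    (tendsto_add_atTop_iff_nat 1).2 (tendsto_expansionError hg hρ)
  have hslim : Tendsto s atTop (𝓝 1) := by
    have h2 := hlim.mul ((tendsto_const_nhds (x := L)).div
      ((tendsto_const_nhds (x := L)).sub hδlim) (by simpa using hL.ne'))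
    simpa [hs, hL.ne'] using h2
  have hsP : ∀ᶠ n in atTop, P n (s n) := by
    filter_upwards [ha, eventually_ge_atTop N, hδlim.eventually_lt_const hL,
      hslim.eventually_const_lt one_pos] with n han hn hδn hsn
    refine ⟨hsn, fun u hu x hx => ?_⟩
    have hg1 : 0 < |binomCoeff lam (n + 1)| := abs_pos.2 (binomCoeff_ne_zero hg _)
    have hLδ : 0 < L - δ (n + 1) := by linarith
    have hbn := hb n hn
    refine (norm_sub_interpolant_le h1 h0 hρ hu n
      (m := |binomCoeff lam (n + 1)| * ρ ^ (n + 1) * (L - δ (n + 1))) (by positivity) ?_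
      han hx).trans (le_of_eq ?_)
    · intro w hw
      refine le_trans ?_ (le_norm_cgeg_joukowski hg hρ (n + 1) hw)
      gcongr
      exact hLle w hw
    · simp only [hs, pow_succ]
      field_simp
  refine ⟨fun n => if P n (s n) then s n else r n, fun n => ?_, ?_, fun u hu n hn x hx => ?_⟩
  · dsimp only
    split_ifs with h
    · exact h.1
    · exact hr0 n
  · refine hslim.congr' ?_
    filter_upwards [hsP] with n hn
    rw [if_pos hn]
  · dsimp only
    split_ifs with h
    · exact h.2 u hu x hx
    · exact (hrP n hn).2 u hu x hx

lemma zpow_neg_two_eq (ρ : ℝ) : ρ ^ (-2 : ℤ) = (ρ ^ 2)⁻¹ := by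
  rw [zpow_neg]
  norm_cast

lemma norm_sq_inv_eq {w : ℂ} (hw : ‖w‖ = ρ) : ‖(w ^ 2)⁻¹‖ = ρ ^ (-2 : ℤ) := by
  rw [norm_inv, norm_pow, hw, zpow_neg_two_eq]

lemma zpow_neg_two_lt_one (hρ : 1 < ρ) : ρ ^ (-2 : ℤ) < 1 := by
  rw [zpow_neg_two_eq]
  exact inv_lt_one_of_one_lt₀ (one_lt_pow₀ hρ two_ne_zero)

lemma norm_one_sub_sq_inv_mem {w : ℂ} (hw : ‖w‖ = ρ) :
    ‖1 - (w ^ 2)⁻¹‖ ∈ Set.Icc (1 - ρ ^ (-2 : ℤ)) (1 + ρ ^ (-2 : ℤ)) := by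
  have h1 := norm_sub_norm_le (1 : ℂ) (w ^ 2)⁻¹
  have h2 := norm_sub_le (1 : ℂ) (w ^ 2)⁻¹
  rw [norm_one, norm_sq_inv_eq hw] at h1 h2
  exact ⟨h1, h2⟩

/-- The Gamma asymptotics at `2 lam` and at `lam` leave a quotient of order `(n+1)^lam`; the shift
from `n + 1` to `n` costs a factor tending to `1`. -/
lemma tendsto_binomCoeff_ratio (hpos : 0 < lam) :
    Tendsto (fun n : ℕ => binomCoeff (2 * lam) (n + 1) / (|binomCoeff lam (n + 1)| *
      (Real.Gamma lam / Real.Gamma (2 * lam) * (n : ℝ) ^ lam))) atTop (𝓝 1) := by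
  have hG : 0 < Real.Gamma lam := Real.Gamma_pos_of_pos hpos
  have hG2 : 0 < Real.Gamma (2 * lam) := Real.Gamma_pos_of_pos (by linarith)
  have t1 := (tendsto_add_atTop_iff_nat 1).2 (tendsto_binomCoeff_mul_rpow (lam := 2 * lam)
    (fun m => by positivity))
  have t2 := (tendsto_add_atTop_iff_nat 1).2 (tendsto_binomCoeff_mul_rpow (lam := lam)
    (fun m => by positivity))
  have t3 := (tendsto_natCast_div_add (lam := 1)).rpow_const (p := lam) (Or.inl one_ne_zero)
  have t4 := ((t1.div t2 (inv_pos.2 hG).ne').div t3 (by simp)).mul_const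
    (Real.Gamma (2 * lam) / Real.Gamma lam)
  have e : (Real.Gamma (2 * lam))⁻¹ / (Real.Gamma lam)⁻¹ / 1 ^ lam *
      (Real.Gamma (2 * lam) / Real.Gamma lam) = 1 := by
    rw [Real.one_rpow]
    field_simp
  rw [e] at t4
  refine t4.congr' ?_
  filter_upwards [eventually_gt_atTop 0] with n hn
  have hn' : (0 : ℝ) < n := by exact_mod_cast hn
  have hn1 : (0 : ℝ) < 1 + n := by positivity
  have hg := binomCoeff_pos hpos (n + 1)
  simp only [Pi.div_apply]
  rw [abs_of_pos hg, Real.div_rpow hn'.le hn1.le]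
  push_cast
  rw [add_comm (n : ℝ) 1, show 1 - 2 * lam = (1 - lam) - lam by ring, Real.rpow_sub hn1 _ lam]
  have := (Real.rpow_pos_of_pos hn1 lam).ne'
  have := (Real.rpow_pos_of_pos hn1 (1 - lam)).ne'
  have := (Real.rpow_pos_of_pos hn' lam).ne'
  field_simp

/-- The Szegő bound and `|g_{n+1}|` have the same power order, so no power of `n` survives and only
`|Γ(lam)|` remains. -/
lemma tendsto_szego_ratio (h1 : -1 / 2 < lam) (h0 : lam ≠ 0) {D : ℝ} (hD : 0 < D) :
    Tendsto (fun n : ℕ => D * ((n + 1 : ℕ) : ℝ) ^ (lam - 1) / (|binomCoeff lam (n + 1)| *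
      (D * |Real.Gamma lam|))) atTop (𝓝 1) := by
  have hg := add_ne_zero_of_neg_half_lt h1 h0
  have hG : Real.Gamma lam ≠ 0 := Real.Gamma_ne_zero fun m hm => hg m (by rw [hm]; ring)
  have t := (((tendsto_add_atTop_iff_nat 1).2 (tendsto_binomCoeff_mul_rpow hg)).mul_const
    (Real.Gamma lam)).abs.inv₀ (by simp [hG])
  rw [inv_mul_cancel₀ hG, abs_one, inv_one] at t
  refine t.congr fun n => ?_
  have hn : (0 : ℝ) < ((n + 1 : ℕ) : ℝ) := by positivity
  have hb := abs_pos.2 (binomCoeff_ne_zero hg (n + 1))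
  have hp := Real.rpow_pos_of_pos hn (1 - lam)
  have hG' := abs_pos.2 hG
  rw [abs_mul, abs_mul, abs_of_pos hp, show lam - 1 = -(1 - lam) by ring, Real.rpow_neg hn.le]
  field_simp

end ErrorConstants

end GegenbauerInterp

end

theorem theorem4p1 (lam ρ : ℝ) (hρ : 1 < ρ) :
    (0 < lam →
      ∃ c : ℕ → ℝ, (∀ n, 0 < c n) ∧ Tendsto c atTop (𝓝 1) ∧
        ∀ u : ℂ → ℂ, AnalyticOnNhd ℂ u (GegenbauerInterp.ellipseRegion ρ) →
          ∀ n : ℕ, 1 ≤ n → ∀ x ∈ Set.Icc (-1 : ℝ) 1,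
            ‖u (x : ℂ) - (GegenbauerInterp.interpolant lam n u).eval (x : ℂ)‖ ≤
              c n * Real.Gamma lam * GegenbauerInterp.maxOnEllipse ρ u *
                  Real.sqrt (ρ ^ 2 + ρ ^ (-2 : ℤ)) /
                (Real.Gamma (2 * lam) * (ρ - 1) ^ 2 * (1 + ρ ^ (-2 : ℤ)) ^ (-lam)) *
                ((n : ℝ) ^ lam / ρ ^ n)) ∧
    (-1 / 2 < lam → lam < 0 →
      (∃ D : ℝ, GegenbauerInterp.IsSzegoConstant lam D) ∧
      ∀ D : ℝ, GegenbauerInterp.IsSzegoConstant lam D →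
        ∃ c : ℕ → ℝ, (∀ n, 0 < c n) ∧ Tendsto c atTop (𝓝 1) ∧
          ∀ u : ℂ → ℂ, AnalyticOnNhd ℂ u (GegenbauerInterp.ellipseRegion ρ) →
            ∀ n : ℕ, ∀ x ∈ Set.Icc (-1 : ℝ) 1,
              ‖u (x : ℂ) - (GegenbauerInterp.interpolant lam n u).eval (x : ℂ)‖ ≤
                c n * D * |Real.Gamma lam| * GegenbauerInterp.maxOnEllipse ρ u *
                    Real.sqrt (ρ ^ 2 + ρ ^ (-2 : ℤ)) /
                  ((ρ - 1) ^ 2 * (1 - ρ ^ (-2 : ℤ)) ^ (-lam)) *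
                  (1 / ρ ^ n)) := by
  open GegenbauerInterp in
  have hz0 : 0 < ρ ^ (-2 : ℤ) := zpow_pos (by linarith) _
  have hz1 := zpow_neg_two_lt_one hρ
  refine ⟨fun hpos => ?_, fun h1 hneg => ⟨exists_isSzegoConstant h1 hneg, fun D hD => ?_⟩⟩
  · have hG : 0 < Real.Gamma lam := Real.Gamma_pos_of_pos hpos
    have hG2 : 0 < Real.Gamma (2 * lam) := Real.Gamma_pos_of_pos (by linarith)
    obtain ⟨c, hc, hlim, hle⟩ := exists_error_constants (by linarith) hpos.ne' hρ
      -- The exponent `-lam` is negative, so the lower bound comes from the upper estimate of `|1 -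
      -- w⁻²|`. The index starts at `1` because `n^lam` vanishes at `n = 0`.
      (L := (1 + ρ ^ (-2 : ℤ)) ^ (-lam)) (by positivity)
      (fun w hw => Real.rpow_le_rpow_of_nonpos
        (by linarith [(norm_one_sub_sq_inv_mem hw).1]) (norm_one_sub_sq_inv_mem hw).2
        (by linarith)) (N := 1)
      (b := fun n => Real.Gamma lam / Real.Gamma (2 * lam) * (n : ℝ) ^ lam)
      (fun n hn => by
        have : (0 : ℝ) < n := by exact_mod_cast hn
        positivity)
      (Eventually.of_forall fun n x hx => abs_eval_gegenbauer_le_of_pos hpos (n + 1) hx)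
      (tendsto_binomCoeff_ratio hpos)
    refine ⟨c, hc, hlim, fun u hu n hn x hx => (hle u hu n hn x hx).trans (le_of_eq ?_)⟩
    generalize (ρ - 1) ^ 2 = d
    simp only [div_eq_mul_inv, mul_inv]
    ring
  · obtain ⟨c, hc, hlim, hle⟩ := exists_error_constants h1 hneg.ne hρ
      -- Now `-lam` is positive, so the lower estimate of `|1 - w⁻²|` is the relevant one.
      (L := (1 - ρ ^ (-2 : ℤ)) ^ (-lam)) (Real.rpow_pos_of_pos (by linarith) _)
      (fun w hw => Real.rpow_le_rpow (by linarith) (norm_one_sub_sq_inv_mem hw).1 (by linarith))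
      (N := 0) (b := fun _ => D * |Real.Gamma lam|)
      (fun n _ => mul_pos hD.1 (abs_pos.2 (Real.Gamma_ne_zero fun m hm =>
        add_ne_zero_of_neg_half_lt h1 hneg.ne m (by rw [hm]; ring))))
      ((tendsto_add_atTop_nat 1).eventually hD.2)
      (tendsto_szego_ratio h1 hneg.ne hD.1)
    refine ⟨c, hc, hlim, fun u hu n x hx => (hle u hu n (Nat.zero_le n) x hx).trans (le_of_eq ?_)⟩
    ring
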